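/- All Hilbert spaces are finite dimensional over $\mathbb{C}$ and $\log$ is to base two. Write $S(\rho)=-\mathrm{tr}(\rho\log\rho)$ for the von Neumann entropy, $F(\rho,\sigma)=\|\sqrt{\rho}\sqrt{\sigma}\|_1^2$ for the fidelity, and $I(A;E,\rho_{AE})=S(\rho_A)+S(\rho_E)-S(\rho_{AE})$ for the quantum mutual information. A pure state vector also denotes the corresponding rank-one density operator. Define $\eta(0)=0$, $\eta(x)=-x\log x$ for $0<x\le 1/e$, and $\eta(x)=\frac{\log e}{e}$ for $x>1/e$. Let $\rho_{AB}$ be a state on $\mathcal{H}_{AB}=\mathcal{H}_A\otimes\mathcal{H}_B$ with a purification $\psi_{ABE}$ on $\mathcal{H}_A\otimes\mathcal{H}_B\otimes\mathcal{H}_E$, with marginal $\rho_{AE}$, and let $\epsilon\in(0,1)$. Let $l,K,L\ge 1$ and $D$ be natural numbers, let $\mathcal{K}_A^0\simeq\mathcal{K}_B^0$ have dimension $K$ and $\mathcal{K}_A^1\simeq\mathcal{K}_B^1$ have dimension $L$, and let $\phi_K\in\mathcal{K}_A^0\otimes\mathcal{K}_B^0$ and $\phi_L\in\mathcal{K}_A^1\otimes\mathcal{K}_B^1$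 be maximally entangled state vectors (so of Schmidt ranks $K$ and $L$). Let $\mathcal{H}_{B'}\simeq\mathcal{H}_A$ be a space at $B$'s site, and let $\psi_{B'BE}$ be the state $\psi_{ABE}$ with its $A$-part located on $\mathcal{H}_{B'}$. Let $$\mathcal{M}=\sum_{k=1}^{D}\mathcal{A}_k\otimes\mathcal{B}_k$$ be an $A\to B$ one-way LOCC channel, where $\{\mathcal{A}_k\}_{k=1}^D$ is an instrument (completely positive trace non-increasing maps whose sum is trace preserving) from $A$'s input system $\mathcal{K}_A^0\otimes\mathcal{H}_A^{\otimes l}$ to $\mathcal{K}_A^1$, and each $\mathcal{B}_k$ is a channel (completely positive and trace preserving) from $B$'s input system $\mathcal{K}_B^0\otimes\mathcal{H}_B^{\otimes l}$ to $\mathcal{K}_B^1\otimes\mathcal{H}_{B'B}^{\otimes l}$. If $$F\big((\mathcal{M}\otimes \mathrm{id}_{\mathcal{H}_E^{\otimes l}})(\phi_K\otimes\psi_{ABE}^{\otimes l}),\ \phi_L\otimes\psi_{B'BE}^{\otimes l}\big)\ \ge\ 1-\epsilon ,$$ then $$\frac1l\log D\ \ge\ I(A;E,\rho_{AE})-6\sqrt{\epsilon}\left(\frac1l\log(KL)+\log\dim\mathcal{H}_{AB}\right)-3\,\eta(2\sqrt{\epsilon}).$$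 -/

import Mathlib

open scoped Kronecker ComplexOrder

namespace StateMerging

/-! Finite-dimensional Hilbert spaces are `ℂ^m` with a finite index type `m`, tensor products are
`ℂ^(m × n)`, and linear operators are matrices. -/

section

variable {m n p q : Type*}

/-- A state: a positive semidefinite operator of trace one. -/
def IsState [Fintype m] (ρ : Matrix m m ℂ) : Prop :=
  ρ.PosSemidef ∧ ρ.trace = 1

/-- The operator `|v⟩⟨v|`. -/
def pureState (v : m → ℂ) : Matrix m m ℂ :=
  Matrix.vecMulVec v (star v)

/-- Partial trace over the second tensor factor. -/
def traceSnd [Fintype n] (X : Matrix (m × n) (m × n) ℂ) : Matrix m m ℂ :=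
  Matrix.of fun i j => ∑ k, X (i, k) (j, k)

/-- Partial trace over the first tensor factor. -/
def traceFst [Fintype m] (X : Matrix (m × n) (m × n) ℂ) : Matrix n n ℂ :=
  Matrix.of fun i j => ∑ k, X (k, i) (k, j)

/-- Partial trace over the middle factor of a tripartite operator. -/
def traceMid [Fintype n] (X : Matrix ((m × n) × p) ((m × n) × p) ℂ) :
    Matrix (m × p) (m × p) ℂ :=
  Matrix.of fun i j => ∑ k, X ((i.1, k), i.2) ((j.1, k), j.2)

/-- The von Neumann entropy `-tr (ρ log ρ)`, to base two. -/
noncomputable def entropy [Fintype m] [DecidableEq m] (ρ : Matrix m m ℂ) : ℝ :=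
  -(ρ * cfc (Real.logb 2) ρ).trace.re

/-- Quantum mutual information `I(X;Y) = S(ρ_X) + S(ρ_Y) - S(ρ_XY)`. -/
noncomputable def mutualInfo [Fintype m] [DecidableEq m] [Fintype n] [DecidableEq n]
    (ρ : Matrix (m × n) (m × n) ℂ) : ℝ :=
  entropy (traceSnd ρ) + entropy (traceFst ρ) - entropy ρ

/-- The trace norm `tr √(X* X)`. -/
noncomputable def traceNorm [Fintype m] [DecidableEq m] (X : Matrix m m ℂ) : ℝ :=
  (cfc Real.sqrt (X.conjTranspose * X)).trace.re

/-- The fidelity `‖√ρ √σ‖₁ ^ 2`. -/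
noncomputable def fidelity [Fintype m] [DecidableEq m] (ρ σ : Matrix m m ℂ) : ℝ :=
  traceNorm (cfc Real.sqrt ρ * cfc Real.sqrt σ) ^ 2

/-- The tensor product `Φ ⊗ Ψ` of linear maps between matrix algebras: the linear map with
`X ⊗ Y ↦ Φ X ⊗ Ψ Y`. -/
noncomputable def tensorMap [Fintype m] [DecidableEq m] [Fintype n] [DecidableEq n]
    [Fintype p] [DecidableEq p] [Fintype q] [DecidableEq q]
    (Φ : Matrix m m ℂ →ₗ[ℂ] Matrix n n ℂ) (Ψ : Matrix p p ℂ →ₗ[ℂ] Matrix q q ℂ) :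
    Matrix (m × p) (m × p) ℂ →ₗ[ℂ] Matrix (n × q) (n × q) ℂ :=
  (kroneckerLinearEquiv n n q q ℂ).toLinearMap ∘ₗ TensorProduct.map Φ Ψ ∘ₗ
    (kroneckerLinearEquiv m m p p ℂ).symm.toLinearMap

theorem tensorMap_kronecker [Fintype m] [DecidableEq m] [Fintype n] [DecidableEq n]
    [Fintype p] [DecidableEq p] [Fintype q] [DecidableEq q]
    (Φ : Matrix m m ℂ →ₗ[ℂ] Matrix n n ℂ) (Ψ : Matrix p p ℂ →ₗ[ℂ] Matrix q q ℂ)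
    (X : Matrix m m ℂ) (Y : Matrix p p ℂ) :
    tensorMap Φ Ψ (X ⊗ₖ Y) = Φ X ⊗ₖ Ψ Y := by
  simp [tensorMap]

/-- Complete positivity: `id_k ⊗ Φ` is positive for every `k`. -/
def IsCP [Fintype m] [DecidableEq m] [Fintype n] [DecidableEq n]
    (Φ : Matrix m m ℂ →ₗ[ℂ] Matrix n n ℂ) : Prop :=
  ∀ (k : ℕ) (X : Matrix (Fin k × m) (Fin k × m) ℂ), X.PosSemidef →
    (tensorMap (LinearMap.id : Matrix (Fin k) (Fin k) ℂ →ₗ[ℂ] _) Φ X).PosSemidef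

def IsTracePreserving [Fintype m] [Fintype n]
    (Φ : Matrix m m ℂ →ₗ[ℂ] Matrix n n ℂ) : Prop :=
  ∀ X, (Φ X).trace = X.trace

def IsTraceNonincreasing [Fintype m] [Fintype n]
    (Φ : Matrix m m ℂ →ₗ[ℂ] Matrix n n ℂ) : Prop :=
  ∀ X : Matrix m m ℂ, X.PosSemidef → (Φ X).trace.re ≤ X.trace.re

/-- A quantum channel: a completely positive trace preserving map. -/
def IsChannel [Fintype m] [DecidableEq m] [Fintype n] [DecidableEq n]
    (Φ : Matrix m m ℂ →ₗ[ℂ] Matrix n n ℂ) : Prop :=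
  IsCP Φ ∧ IsTracePreserving Φ

/-- An instrument with `D` outcomes: completely positive trace non-increasing maps whose sum is
trace preserving. -/
def IsInstrument [Fintype m] [DecidableEq m] [Fintype n] [DecidableEq n] {D : ℕ}
    (𝒜 : Fin D → (Matrix m m ℂ →ₗ[ℂ] Matrix n n ℂ)) : Prop :=
  (∀ k, IsCP (𝒜 k) ∧ IsTraceNonincreasing (𝒜 k)) ∧ IsTracePreserving (∑ k, 𝒜 k)

/-- `ℳ` is an `A → B` one-way LOCC channel in which `A` distinguishes `D` measurement outcomes:
`ℳ = ∑ k, 𝒜 k ⊗ ℬ k` for an instrument `𝒜` of `A` and channels `ℬ k` of `B`. Here `m, p` index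
the input systems of `A` and `B`, and `n, q` their output systems. -/
def IsOneWayLOCC [Fintype m] [DecidableEq m] [Fintype n] [DecidableEq n]
    [Fintype p] [DecidableEq p] [Fintype q] [DecidableEq q] (D : ℕ)
    (ℳ : Matrix (m × p) (m × p) ℂ →ₗ[ℂ] Matrix (n × q) (n × q) ℂ) : Prop :=
  ∃ (𝒜 : Fin D → (Matrix m m ℂ →ₗ[ℂ] Matrix n n ℂ))
    (ℬ : Fin D → (Matrix p p ℂ →ₗ[ℂ] Matrix q q ℂ)),
    IsInstrument 𝒜 ∧ (∀ k, IsChannel (ℬ k)) ∧ ℳ = ∑ k, tensorMap (𝒜 k) (ℬ k)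

end

/-- `φ` is a maximally entangled state vector of Schmidt rank `K` on `ℂ^K ⊗ ℂ^K`:
`φ = K^(-1/2) ∑ k, e k ⊗ f k` for orthonormal bases `e`, `f`. -/
def IsMaxEntangled {K : ℕ} (φ : Fin K × Fin K → ℂ) : Prop :=
  ∃ e f : OrthonormalBasis (Fin K) ℂ (EuclideanSpace ℂ (Fin K)),
    ∀ i j, φ (i, j) = ((1 / Real.sqrt K : ℝ) : ℂ) * ∑ k, e k i * f k j

section

variable {a b e : Type*}

/-- `ψ` is a (vector representing a) purification of `ρ` on the space `ℂ^(a × b) ⊗ ℂ^e`. -/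
def IsPurification [Fintype e] (ψ : (a × b) × e → ℂ) (ρ : Matrix (a × b) (a × b) ℂ) : Prop :=
  traceSnd (pureState ψ) = ρ

/-- The state vector `ψ^{⊗ l}` of `l` copies; the `l` copies of `A`, of `B` and of `E` are
indexed by functions on `Fin l`. -/
def tensorPower (l : ℕ) (ψ : (a × b) × e → ℂ) (x : Fin l → a) (y : Fin l → b) (z : Fin l → e) : ℂ :=
  ∏ i, ψ ((x i, y i), z i)

/-- The input vector `φ_K ⊗ ψ_ABE^{⊗ l}`. The tensor factors are ordered as
(`K_A⁰ ⊗ A^l`) `⊗` (`K_B⁰ ⊗ B^l`) `⊗ E^l`: first `A`'s systems, then `B`'s, then `E`'s. -/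
def inputVector {K : ℕ} (l : ℕ) (φ : Fin K × Fin K → ℂ) (ψ : (a × b) × e → ℂ) :
    (((Fin K × (Fin l → a)) × (Fin K × (Fin l → b))) × (Fin l → e)) → ℂ :=
  fun s => φ (s.1.1.1, s.1.2.1) * tensorPower l ψ s.1.1.2 s.1.2.2 s.2

/-- The target vector `φ_L ⊗ ψ_B'BE^{⊗ l}`, in which the `A`-part of `ψ` is located on a system
`B'` at `B`'s site. The tensor factors are ordered as
`K_A¹ ⊗` (`K_B¹ ⊗ B'^l ⊗ B^l`) `⊗ E^l`: first `A`'s system, then `B`'s, then `E`'s. -/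
def targetVector {L : ℕ} (l : ℕ) (φ : Fin L × Fin L → ℂ) (ψ : (a × b) × e → ℂ) :
    ((Fin L × (Fin L × (Fin l → a) × (Fin l → b))) × (Fin l → e)) → ℂ :=
  fun s => φ (s.1.1, s.1.2.1) * tensorPower l ψ s.1.2.2.1 s.1.2.2.2 s.2

set_option synthInstance.maxSize 1000 in
/-- The merging fidelity
`F((ℳ ⊗ id_{E^l})(φ_K ⊗ ψ_ABE^{⊗ l}), φ_L ⊗ ψ_B'BE^{⊗ l})`. -/
noncomputable def mergingFidelity [Fintype a] [DecidableEq a] [Fintype b] [DecidableEq b]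
    [Fintype e] [DecidableEq e] {K L : ℕ} (l : ℕ)
    (ℳ : Matrix ((Fin K × (Fin l → a)) × (Fin K × (Fin l → b)))
          ((Fin K × (Fin l → a)) × (Fin K × (Fin l → b))) ℂ →ₗ[ℂ]
        Matrix (Fin L × (Fin L × (Fin l → a) × (Fin l → b)))
          (Fin L × (Fin L × (Fin l → a) × (Fin l → b))) ℂ)
    (φK : Fin K × Fin K → ℂ) (φL : Fin L × Fin L → ℂ) (ψ : (a × b) × e → ℂ) : ℝ :=
  fidelity
    (tensorMap ℳ (LinearMap.id : Matrix (Fin l → e) (Fin l → e) ℂ →ₗ[ℂ] _)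
      (pureState (inputVector l φK ψ)))
    (pureState (targetVector l φL ψ))

end

/-- The function `η`, with `η 0 = 0`, `η x = -x log x` for `0 < x ≤ 1/e`, and the constant value
`(log e)/e` for `x > 1/e`; logarithms are to base two. -/
noncomputable def eta (x : ℝ) : ℝ :=
  if x ≤ 0 then 0
  else if x ≤ 1 / Real.exp 1 then -x * Real.logb 2 x
  else Real.logb 2 (Real.exp 1) / Real.exp 1

end StateMerging

/-!
The lower bound on the classical communication follows the flow of correlations with the reference
`E`. Before the protocol the conditional entropy of `E` given the systems of `A` is `S(AE) - S(A)
= S(B) - S(BE)`, the negative of `condEnt` of the `BE` marginal. A measurement of `A` with `D`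
outcomes can increase its average by at most `log D` (`sum_condEnt_afterA_le`): by superadditivity
of the homogeneous entropy `nent` and subadditivity of `vN` under sums, `S(B)` can only decrease
on average and `S(BE)` decreases by at most `log D`. The isometries by which `B` decodes do not
affect this quantity. At the end `E` is decoupled from `A` and from the environment of `A`'s
measurement, so that its conditional entropy there is close to `S(E)`. For exact merging this
reads `log D ≥ S(E) + S(BE) - S(B) = I(A;E)` for the joint state of the `l` copies.

Strong subadditivity is not needed. Since the target is pure, the vector `v + w` obtained for each
outcome splits into `v`, a product of the target and some vector of the environments, and an
orthogonal error `w`. The operator identity `|v + w⟩⟨v + w| + |z⟩⟨z| = (1 - s²)⁻¹ |v⟩⟨v| +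
|y⟩⟨y|`, where `s = √ε`, involves only positive terms, and the weights of `|z⟩⟨z|` and `|y⟩⟨y|`,
summed over the outcomes, are at most `s`. Conditional entropy is additive up to the entropy of
mixing (`condEnt_add_ge`, `condEnt_add_le`), and the conditional entropy of the small terms is at
most their weight times the logarithm of the rank of their `E` marginal (`condEnt_le_rank`,
`neg_rank_le_condEnt`; subadditivity and the Araki–Lieb inequality). That rank is at most `(dim
AB)^l`, because all vectors arise from `ψ^{⊗ l}` by operators that do not touch `E`. This gives
`condEnt_perturb` and, summed over the outcomes, `one_shot`.

Everything about entropy rests on two facts: `X Y` and `Y X` have the same nonzero spectrum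
(`vN_mul_comm`), and the diagonal of an operator in any orthonormal basis has at least the entropy
of its spectrum (`vN_le_diag`). The mixing terms are estimated by Gibbs' inequality (`error_le`).
For `√ε ≥ 1/3` the claim follows from `I(A;E) ≤ 2 log dim A`.
-/

namespace StateMerging

open Matrix Real

variable {m n p q : Type*} [Fintype m] [DecidableEq m] [Fintype n] [DecidableEq n]
  [Fintype p] [DecidableEq p] [Fintype q] [DecidableEq q]

/-! ### Two scalar inequalities -/

/-- `(x + y) h₂(x / (x + y))` with `h₂` the binary entropy in nats: the entropy of mixing parts of
weights `x` and `y`, homogeneous of degree one. -/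
noncomputable def mixEntropy (x y : ℝ) : ℝ :=
  negMulLog x + negMulLog y - negMulLog (x + y)

/-- Gibbs' inequality for one term: `x log (x / y) ≥ x - y`. -/
theorem negMulLog_le_gibbs {x y : ℝ} (hx : 0 ≤ x) (hy : 0 < y) :
    negMulLog x ≤ -x * log y + y - x := by
  rcases hx.eq_or_lt with rfl | hx
  · simpa using hy.le
  · have h := log_le_sub_one_of_pos (div_pos hy hx)
    rw [log_div hy.ne' hx.ne'] at h
    have h2 := mul_le_mul_of_nonneg_left h hx.le
    have h3 : x * (y / x - 1) = y - x := by field_simp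
    rw [negMulLog]
    linarith

theorem mixEntropy_le {x y a b : ℝ} (hx : 0 ≤ x) (hy : 0 ≤ y) (ha : 0 < a) (hb : 0 < b) :
    mixEntropy x y ≤ x * log ((a + b) / a) + y * log ((a + b) / b) := by
  rw [log_div (by positivity) ha.ne', log_div (by positivity) hb.ne', mixEntropy]
  rcases (add_nonneg hx hy).eq_or_lt with h | h
  · obtain rfl : x = 0 := by linarith
    obtain rfl : y = 0 := by linarith
    simp
  · have hab : 0 < a + b := by positivity
    have h1 := negMulLog_le_gibbs hx (y := (x + y) * (a / (a + b))) (by positivity)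
    have h2 := negMulLog_le_gibbs hy (y := (x + y) * (b / (a + b))) (by positivity)
    rw [log_mul h.ne' (by positivity), log_div ha.ne' hab.ne'] at h1
    rw [log_mul h.ne' (by positivity), log_div hb.ne' hab.ne'] at h2
    have h3 : (x + y) * (a / (a + b)) + (x + y) * (b / (a + b)) = x + y := by field_simp
    rw [show negMulLog (x + y) = -(x + y) * log (x + y) from rfl]
    linear_combination h1 + h2 + h3

/-- Log-sum inequality. -/
theorem sum_mixEntropy_le {ι : Type*} (s : Finset ι) {x y : ι → ℝ} (hx : ∀ i, 0 ≤ x i)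
    (hy : ∀ i, 0 ≤ y i) :
    ∑ i ∈ s, mixEntropy (x i) (y i) ≤ mixEntropy (∑ i ∈ s, x i) (∑ i ∈ s, y i) := by
  rcases (Finset.sum_nonneg fun i _ => hx i : 0 ≤ ∑ i ∈ s, x i).eq_or_lt with h | h
  · have h0 := (Finset.sum_eq_zero_iff_of_nonneg fun i _ => hx i).1 h.symm
    rw [Finset.sum_eq_zero fun i hi => by rw [h0 i hi]; simp [mixEntropy], ← h]
    simp [mixEntropy]
  rcases (Finset.sum_nonneg fun i _ => hy i : 0 ≤ ∑ i ∈ s, y i).eq_or_lt with h' | h'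
  · have h0 := (Finset.sum_eq_zero_iff_of_nonneg fun i _ => hy i).1 h'.symm
    rw [Finset.sum_eq_zero fun i hi => by rw [h0 i hi]; simp [mixEntropy], ← h']
    simp [mixEntropy]
  refine (Finset.sum_le_sum fun i _ => mixEntropy_le (hx i) (hy i) h h').trans_eq ?_
  rw [Finset.sum_add_distrib, ← Finset.sum_mul, ← Finset.sum_mul,
    log_div (by positivity) h.ne', log_div (by positivity) h'.ne']
  simp only [mixEntropy, negMulLog]
  ring

/-! ### Entropy of unnormalized positive operators -/

/-- The entropy `-tr (M log M)` in nats of a (not necessarily normalized) positive semidefinite `M`,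
as a sum over the roots of the characteristic polynomial. In this form it is evident that
`X Y` and `Y X` have the same entropy. -/
noncomputable def vN (M : Matrix m m ℂ) : ℝ :=
  (M.charpoly.roots.map fun z => negMulLog z.re).sum

theorem vN_eq_sum {M : Matrix m m ℂ} (h : M.IsHermitian) :
    vN M = ∑ i, negMulLog (h.eigenvalues i) := by
  rw [vN, h.roots_charpoly_eq_eigenvalues, Multiset.map_map]
  simp only [Function.comp_def, Complex.coe_algebraMap, ← RCLike.re_eq_complex_re]
  rfl

theorem entropy_eq {M : Matrix m m ℂ} (h : M.IsHermitian) : entropy M = vN M / log 2 := by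
  have h1 : M * cfc (logb 2) M = cfc (fun x => x * logb 2 x) M := by
    rw [cfc_mul (fun x : ℝ => x) (logb 2) M (by fun_prop)
      (M.finite_real_spectrum.continuousOn _), cfc_id' ℝ M h.isSelfAdjoint]
  rw [entropy, h1, h.cfc_eq, IsHermitian.cfc, Unitary.conjStarAlgAut_apply, trace_mul_comm,
    ← mul_assoc, vN_eq_sum h]
  have h2 : (star (h.eigenvectorUnitary : Matrix m m ℂ)) * h.eigenvectorUnitary = 1 :=
    Unitary.coe_star_mul_self _
  rw [h2, one_mul, trace_diagonal, Complex.re_sum, Finset.sum_div, ← Finset.sum_neg_distrib]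
  refine Finset.sum_congr rfl fun i _ => ?_
  simp only [Function.comp_apply, Complex.coe_algebraMap, Complex.ofReal_re, logb, negMulLog]
  ring

theorem vN_mul_comm (A : Matrix m n ℂ) (B : Matrix n m ℂ) : vN (A * B) = vN (B * A) := by
  have h := congrArg (fun P : Polynomial ℂ => (P.roots.map fun z => negMulLog z.re).sum)
    (charpoly_mul_comm' A B)
  rw [Polynomial.roots_mul, Polynomial.roots_mul] at h
  · simpa [vN, Multiset.map_nsmul, Multiset.sum_nsmul] using h
  · exact mul_ne_zero (pow_ne_zero _ Polynomial.X_ne_zero) (charpoly_monic _).ne_zero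
  · exact mul_ne_zero (pow_ne_zero _ Polynomial.X_ne_zero) (charpoly_monic _).ne_zero

theorem vN_transpose (M : Matrix m m ℂ) : vN Mᵀ = vN M := by simp [vN, charpoly_transpose]

theorem vN_submatrix (e : n ≃ m) (M : Matrix m m ℂ) : vN (M.submatrix e e) = vN M := by
  rw [vN, vN, ← charpoly_reindex e.symm M]; rfl

/-- Every positive semidefinite operator is diagonal in an orthonormal basis. -/
theorem exists_diagonalization {M : Matrix m m ℂ} (h : M.PosSemidef) :
    ∃ (U : Matrix m m ℂ) (d : m → ℝ), Uᴴ * U = 1 ∧ U * Uᴴ = 1 ∧ (∀ i, 0 ≤ d i) ∧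
      M = U * diagonal (fun i => (d i : ℂ)) * Uᴴ ∧
      (Finset.univ.filter fun i => d i ≠ 0).card = M.rank := by
  refine ⟨h.1.eigenvectorUnitary, h.1.eigenvalues, ?_, ?_, h.eigenvalues_nonneg, ?_, ?_⟩
  · exact Unitary.coe_star_mul_self h.1.eigenvectorUnitary
  · exact Unitary.coe_mul_star_self h.1.eigenvectorUnitary
  · conv_lhs => rw [h.1.spectral_theorem, Unitary.conjStarAlgAut_apply]
    rfl
  · rw [h.1.rank_eq_card_non_zero_eigs, Fintype.card_subtype]

theorem vN_diagonal (d : m → ℝ) : vN (diagonal fun i => (d i : ℂ)) = ∑ i, negMulLog (d i) := by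
  rw [vN, charpoly_diagonal, Polynomial.roots_prod]
  · simp only [Polynomial.roots_X_sub_C, Multiset.bind_singleton, Multiset.map_map]
    rfl
  · simp [Finset.prod_ne_zero_iff, Polynomial.X_sub_C_ne_zero]

theorem vN_conj {U : Matrix m m ℂ} (hU : Uᴴ * U = 1) (M : Matrix m m ℂ) :
    vN (U * M * Uᴴ) = vN M := by
  rw [vN_mul_comm, ← mul_assoc, hU, one_mul]

theorem trace_conj {U : Matrix m m ℂ} (hU : Uᴴ * U = 1) (M : Matrix m m ℂ) :
    (U * M * Uᴴ).trace = M.trace := by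
  rw [trace_mul_comm, ← mul_assoc, hU, one_mul]

theorem diag_re_nonneg {k : Type*} {M : Matrix k k ℂ} (h : M.PosSemidef) (i : k) : 0 ≤ (M i i).re :=
  (Complex.le_def.1 (h.diag_nonneg (i := i))).1

theorem trace_re_nonneg {k : Type*} [Fintype k] {M : Matrix k k ℂ} (h : M.PosSemidef) :
    0 ≤ M.trace.re := by
  rw [trace, Complex.re_sum]
  exact Finset.sum_nonneg fun i _ => diag_re_nonneg h i

/-- The diagonal of `M` is a doubly stochastic image of the eigenvalues of `M`. -/
theorem vN_le_diag {M : Matrix m m ℂ} (h : M.PosSemidef) :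
    vN M ≤ ∑ i, negMulLog (M i i).re := by
  obtain ⟨U, d, hU, hU', hd, hM, -⟩ := exists_diagonalization h
  have hdiag : ∀ i, (M i i).re = ∑ j, Complex.normSq (U i j) * d j := by
    intro i
    rw [hM, mul_apply, Complex.re_sum]
    refine Finset.sum_congr rfl fun j _ => ?_
    rw [mul_diagonal, conjTranspose_apply, mul_right_comm, Complex.star_def, Complex.mul_conj,
      ← Complex.ofReal_mul, Complex.ofReal_re]
  have hrow : ∀ i, ∑ j, Complex.normSq (U i j) = 1 := by
    intro i
    have := congrFun (congrFun hU' i) i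
    rw [mul_apply, one_apply_eq] at this
    have h2 := congrArg Complex.re this
    rw [Complex.re_sum] at h2
    simpa [conjTranspose_apply, Complex.mul_conj] using h2
  have hcol : ∀ j, ∑ i, Complex.normSq (U i j) = 1 := by
    intro i
    have := congrFun (congrFun hU i) i
    rw [mul_apply, one_apply_eq] at this
    have h2 := congrArg Complex.re this
    rw [Complex.re_sum] at h2
    simpa [conjTranspose_apply, mul_comm _ (U _ _), Complex.mul_conj] using h2
  have hv : vN M = ∑ j, negMulLog (d j) := by
    rw [hM, vN_conj hU, vN_diagonal]
  calc vN M = ∑ j, (∑ i, Complex.normSq (U i j)) * negMulLog (d j) := by simp [hv, hcol]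
    _ = ∑ i, ∑ j, Complex.normSq (U i j) * negMulLog (d j) := by
      simp_rw [Finset.sum_mul]; exact Finset.sum_comm
    _ ≤ _ := by
      refine Finset.sum_le_sum fun i _ => ?_
      rw [hdiag]
      exact concaveOn_negMulLog.le_map_sum (fun j _ => Complex.normSq_nonneg _) (hrow i)
        fun j _ => hd j

/-- A positive semidefinite operator is `X Xᴴ` for some `X` with orthogonal columns. -/
theorem exists_sqrt_orthogonal {M : Matrix m m ℂ} (h : M.PosSemidef) :
    ∃ X : Matrix m m ℂ, M = X * Xᴴ ∧ vN M = ∑ i, negMulLog ((Xᴴ * X) i i).re := by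
  obtain ⟨U, d, hU, hU', hd, hM, -⟩ := exists_diagonalization h
  refine ⟨U * diagonal fun i => ((√(d i) : ℝ) : ℂ), ?_, ?_⟩
  · rw [hM, conjTranspose_mul, diagonal_conjTranspose, ← mul_assoc (U * _),
      mul_assoc U (diagonal _) (diagonal _), diagonal_mul_diagonal]
    congr 3
    ext i
    simp [← Complex.ofReal_mul, mul_self_sqrt (hd i)]
  · rw [conjTranspose_mul, ← mul_assoc, mul_assoc _ Uᴴ, hU, mul_one, diagonal_conjTranspose,
      diagonal_mul_diagonal, hM, vN_conj hU, vN_diagonal]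
    refine Finset.sum_congr rfl fun i _ => ?_
    simp [← Complex.ofReal_mul, mul_self_sqrt (hd i)]

theorem vN_add_le {M N : Matrix m m ℂ} (hM : M.PosSemidef) (hN : N.PosSemidef) :
    vN (M + N) ≤ vN M + vN N := by
  obtain ⟨X, rfl, hX⟩ := exists_sqrt_orthogonal hM
  obtain ⟨Y, rfl, hY⟩ := exists_sqrt_orthogonal hN
  have h : X * Xᴴ + Y * Yᴴ = fromCols X Y * (fromCols X Y)ᴴ := by
    rw [conjTranspose_fromCols_eq_fromRows_conjTranspose, fromCols_mul_fromRows]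
  rw [h, vN_mul_comm, hX, hY]
  refine (vN_le_diag (posSemidef_conjTranspose_mul_self _)).trans_eq ?_
  rw [conjTranspose_fromCols_eq_fromRows_conjTranspose, fromRows_mul_fromCols,
    Fintype.sum_sum_type]
  simp

/-- The homogeneous entropy `tr M · S (M / tr M)`. -/
noncomputable def nent (M : Matrix m m ℂ) : ℝ := vN M - negMulLog M.trace.re

theorem nent_add_ge {M N : Matrix m m ℂ} (hM : M.PosSemidef) (hN : N.PosSemidef) :
    nent M + nent N ≤ nent (M + N) := by
  obtain ⟨U, d, hU, hU', hd, hMN, -⟩ := exists_diagonalization (hM.add hN)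
  have hU2 : Uᴴᴴ * Uᴴ = 1 := by rw [conjTranspose_conjTranspose, hU']
  have key : ∀ {P : Matrix m m ℂ}, P.PosSemidef → (Uᴴ * P * U).PosSemidef := fun hP =>
    hP.conjTranspose_mul_mul_same U
  have htr : ∀ P : Matrix m m ℂ, ∑ i, ((Uᴴ * P * U) i i).re = P.trace.re := by
    intro P
    rw [← trace_conj hU2 P, conjTranspose_conjTranspose, trace, Complex.re_sum]
    rfl
  have hle : ∀ {P : Matrix m m ℂ}, P.PosSemidef →
      vN P ≤ ∑ i, negMulLog ((Uᴴ * P * U) i i).re := by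
    intro P hP
    rw [← vN_conj hU2 P, conjTranspose_conjTranspose]
    exact vN_le_diag (key hP)
  have heq : vN (M + N) = ∑ i, negMulLog (((Uᴴ * M * U) i i).re + ((Uᴴ * N * U) i i).re) := by
    have h1 : Uᴴ * (M + N) * U = diagonal fun i => (d i : ℂ) := by
      rw [hMN, ← mul_assoc, ← mul_assoc, hU, one_mul, mul_assoc, hU, mul_one]
    rw [← vN_conj hU2 (M + N), conjTranspose_conjTranspose, h1, vN_diagonal]
    refine Finset.sum_congr rfl fun i _ => ?_
    rw [← Complex.add_re, ← Matrix.add_apply, ← add_mul, ← mul_add, h1]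
    simp
  have hls := sum_mixEntropy_le Finset.univ (fun i => diag_re_nonneg (key hM) i)
    (fun i => diag_re_nonneg (key hN) i)
  rw [htr, htr] at hls
  simp only [mixEntropy, Finset.sum_sub_distrib, Finset.sum_add_distrib] at hls
  rw [nent, nent, nent, heq, trace_add, Complex.add_re]
  linarith [hle hM, hle hN]

theorem vN_zero : vN (0 : Matrix m m ℂ) = 0 := by
  have := vN_diagonal (fun _ : m => (0 : ℝ))
  simpa using this

theorem vN_sum_le {ι : Type*} (s : Finset ι) {M : ι → Matrix m m ℂ} (h : ∀ i, (M i).PosSemidef) :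
    vN (∑ i ∈ s, M i) ≤ ∑ i ∈ s, vN (M i) := by
  classical
  induction s using Finset.induction_on with
  | empty => simp [vN_zero]
  | insert i s hi ih =>
    rw [Finset.sum_insert hi, Finset.sum_insert hi]
    exact (vN_add_le (h i) (posSemidef_sum s fun j _ => h j)).trans (by linarith)

theorem nent_sum_ge {ι : Type*} (s : Finset ι) {M : ι → Matrix m m ℂ}
    (h : ∀ i, (M i).PosSemidef) :
    ∑ i ∈ s, nent (M i) ≤ nent (∑ i ∈ s, M i) := by
  classical
  induction s using Finset.induction_on with
  | empty => simp [nent, vN_zero]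
  | insert i s hi ih =>
    rw [Finset.sum_insert hi, Finset.sum_insert hi]
    exact le_trans (by linarith) (nent_add_ge (h i) (posSemidef_sum s fun j _ => h j))

theorem nent_nonneg {M : Matrix m m ℂ} (h : M.PosSemidef) : 0 ≤ nent M := by
  obtain ⟨U, x, hU, -, hx, hM, -⟩ := exists_diagonalization h
  have hv : vN M = ∑ i, negMulLog (x i) := by rw [hM, vN_conj hU, vN_diagonal]
  have ht : M.trace.re = ∑ i, x i := by
    rw [hM, trace_conj hU, trace_diagonal, Complex.re_sum]; simp
  have key : ∀ i, -(x i * log (∑ i, x i)) ≤ negMulLog (x i) := by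
    intro i
    rw [negMulLog, neg_mul, neg_le_neg_iff]
    rcases (hx i).eq_or_lt with h0 | h0
    · simp [← h0]
    · exact mul_le_mul_of_nonneg_left
        (log_le_log h0 (Finset.single_le_sum (fun j _ => hx j) (Finset.mem_univ i))) h0.le
  have := Finset.sum_le_sum fun i (_ : i ∈ Finset.univ) => key i
  rw [Finset.sum_neg_distrib, ← Finset.sum_mul] at this
  rw [nent, hv, ht, negMulLog]
  linarith

theorem nent_le_rank {M : Matrix m m ℂ} (h : M.PosSemidef) {d : ℕ} (hd : M.rank ≤ d) :
    nent M ≤ M.trace.re * log d := by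
  obtain ⟨U, x, hU, hU', hx, hM, hr⟩ := exists_diagonalization h
  have hv : vN M = ∑ i, negMulLog (x i) := by rw [hM, vN_conj hU, vN_diagonal]
  have ht : M.trace.re = ∑ i, x i := by
    rw [hM, trace_conj hU, trace_diagonal, Complex.re_sum]; simp
  set s := Finset.univ.filter fun i => x i ≠ 0 with hs
  have hv' : vN M = ∑ i ∈ s, negMulLog (x i) := by
    rw [hv]
    refine (Finset.sum_subset (Finset.subset_univ s) fun i _ hi => ?_).symm
    simp only [hs, Finset.mem_filter, Finset.mem_univ, true_and, not_not] at hi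
    simp [hi]
  have ht' : M.trace.re = ∑ i ∈ s, x i := by
    rw [ht]
    refine (Finset.sum_subset (Finset.subset_univ s) fun i _ hi => ?_).symm
    simpa [hs] using hi
  rcases (trace_re_nonneg h).eq_or_lt with h0 | h0
  · have : s = ∅ := by
      by_contra hne
      obtain ⟨i, hi⟩ := Finset.nonempty_iff_ne_empty.2 hne
      have : ∀ i ∈ s, x i = 0 :=
        (Finset.sum_eq_zero_iff_of_nonneg fun i _ => hx i).1 (ht'.symm.trans h0.symm)
      exact (Finset.mem_filter.1 hi).2 (this i hi)
    simp [nent, hv', this, ← h0]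
  · have hd0 : 0 < d := by
      rcases Nat.eq_zero_or_pos d with rfl | h'
      · have : s = ∅ := Finset.card_eq_zero.1 (by omega)
        rw [ht', this] at h0; simp at h0
      · exact h'
    have hdR : (0 : ℝ) < d := by exact_mod_cast hd0
    set t := M.trace.re
    have hc : (0 : ℝ) < t / d := by positivity
    have h1 : vN M ≤ ∑ i ∈ s, (-x i * log (t / d) + t / d - x i) := by
      rw [hv']
      exact Finset.sum_le_sum fun i _ => negMulLog_le_gibbs (hx i) hc
    rw [Finset.sum_sub_distrib, Finset.sum_add_distrib, ← Finset.sum_mul, Finset.sum_neg_distrib,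
      ← ht', Finset.sum_const, nsmul_eq_mul, log_div h0.ne' hdR.ne'] at h1
    have hcard : (s.card : ℝ) * (t / d) ≤ t := by
      have : (s.card : ℝ) ≤ d := by exact_mod_cast hr.trans_le hd
      calc (s.card : ℝ) * (t / d) ≤ d * (t / d) := by gcongr
        _ = t := by field_simp
    rw [nent, negMulLog]
    linarith

/-! ### Partial traces and subadditivity -/

theorem kronecker_induction {P : Matrix (m × n) (m × n) ℂ → Prop} (h0 : P 0)
    (hadd : ∀ X Y, P X → P Y → P (X + Y)) (hk : ∀ A B, P (A ⊗ₖ B)) (M) : P M := by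
  obtain ⟨T, rfl⟩ := (kroneckerLinearEquiv m m n n ℂ).surjective M
  induction T using TensorProduct.induction_on with
  | zero => simpa using h0
  | tmul A B => simpa using hk A B
  | add X Y hX hY => simpa using hadd _ _ hX hY

section
variable {m n : Type*}

theorem traceSnd_eq_sum [Fintype n] (M : Matrix (m × n) (m × n) ℂ) :
    traceSnd M = ∑ k, M.submatrix (fun i => (i, k)) (fun i => (i, k)) := by
  ext i j; simp [traceSnd, Matrix.sum_apply]

theorem traceFst_eq_sum [Fintype m] (M : Matrix (m × n) (m × n) ℂ) :
    traceFst M = ∑ k, M.submatrix (fun i => (k, i)) (fun i => (k, i)) := by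
  ext i j; simp [traceFst, Matrix.sum_apply]

theorem posSemidef_traceSnd [Fintype n] {M : Matrix (m × n) (m × n) ℂ} (h : M.PosSemidef) :
    (traceSnd M).PosSemidef := by
  rw [traceSnd_eq_sum]; exact posSemidef_sum _ fun k _ => h.submatrix _

theorem posSemidef_traceFst [Fintype m] {M : Matrix (m × n) (m × n) ℂ} (h : M.PosSemidef) :
    (traceFst M).PosSemidef := by
  rw [traceFst_eq_sum]; exact posSemidef_sum _ fun k _ => h.submatrix _

theorem traceSnd_add [Fintype n] (M N : Matrix (m × n) (m × n) ℂ) :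
    traceSnd (M + N) = traceSnd M + traceSnd N := by
  ext i j; simp [traceSnd, Finset.sum_add_distrib]

theorem traceFst_add [Fintype m] (M N : Matrix (m × n) (m × n) ℂ) :
    traceFst (M + N) = traceFst M + traceFst N := by
  ext i j; simp [traceFst, Finset.sum_add_distrib]

theorem traceSnd_sum [Fintype n] {ι : Type*} (s : Finset ι) (M : ι → Matrix (m × n) (m × n) ℂ) :
    traceSnd (∑ i ∈ s, M i) = ∑ i ∈ s, traceSnd (M i) := by
  ext i j; simp only [traceSnd, Matrix.sum_apply, of_apply]; exact Finset.sum_comm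

theorem traceSnd_kronecker [Fintype n] (A : Matrix m m ℂ) (B : Matrix n n ℂ) :
    traceSnd (A ⊗ₖ B) = B.trace • A := by
  ext i j; simp [traceSnd, trace, Finset.sum_mul, mul_comm (A i j)]

theorem traceFst_kronecker [Fintype m] (A : Matrix m m ℂ) (B : Matrix n n ℂ) :
    traceFst (A ⊗ₖ B) = A.trace • B := by
  ext i j; simp [traceFst, trace, Finset.sum_mul]

theorem trace_traceSnd [Fintype m] [Fintype n] (M : Matrix (m × n) (m × n) ℂ) :
    (traceSnd M).trace = M.trace := by
  simp [traceSnd, trace, Fintype.sum_prod_type]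

theorem trace_traceFst [Fintype m] [Fintype n] (M : Matrix (m × n) (m × n) ℂ) :
    (traceFst M).trace = M.trace := by
  simp [traceFst, trace, Fintype.sum_prod_type_right]

end

theorem traceSnd_conj (U : Matrix m m ℂ) {V : Matrix n n ℂ} (hV : V * Vᴴ = 1)
    (M : Matrix (m × n) (m × n) ℂ) :
    traceSnd ((U ⊗ₖ V)ᴴ * M * (U ⊗ₖ V)) = Uᴴ * traceSnd M * U := by
  induction M using kronecker_induction with
  | h0 => simp [traceSnd_eq_sum]
  | hadd X Y hX hY => simp only [mul_add, add_mul, traceSnd_add, hX, hY]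
  | hk A B =>
    have : (Vᴴ * B * V).trace = B.trace := by rw [trace_mul_comm, ← mul_assoc, hV, one_mul]
    rw [conjTranspose_kronecker, ← mul_kronecker_mul, ← mul_kronecker_mul, traceSnd_kronecker,
      traceSnd_kronecker, this]
    simp

theorem traceFst_conj {U : Matrix m m ℂ} (hU : U * Uᴴ = 1) (V : Matrix n n ℂ)
    (M : Matrix (m × n) (m × n) ℂ) :
    traceFst ((U ⊗ₖ V)ᴴ * M * (U ⊗ₖ V)) = Vᴴ * traceFst M * V := by
  induction M using kronecker_induction with
  | h0 => simp [traceFst_eq_sum]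
  | hadd X Y hX hY => simp only [mul_add, add_mul, traceFst_add, hX, hY]
  | hk A B =>
    have : (Uᴴ * A * U).trace = A.trace := by rw [trace_mul_comm, ← mul_assoc, hU, one_mul]
    rw [conjTranspose_kronecker, ← mul_kronecker_mul, ← mul_kronecker_mul, traceFst_kronecker,
      traceFst_kronecker, this]
    simp

theorem kronecker_unitary {U : Matrix m m ℂ} {V : Matrix n n ℂ} (hU : Uᴴ * U = 1)
    (hV : Vᴴ * V = 1) : (U ⊗ₖ V)ᴴ * (U ⊗ₖ V) = 1 := by
  rw [conjTranspose_kronecker, ← mul_kronecker_mul, hU, hV, one_kronecker_one]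

/-- Subadditivity of the classical entropy, for an unnormalized joint distribution. -/
theorem sum_negMulLog_subadditive {m n : Type*} [Fintype m] [Fintype n] {w : m × n → ℝ}
    (hw : ∀ x, 0 ≤ w x) :
    ∑ x, negMulLog (w x) + negMulLog (∑ x, w x) ≤
      ∑ i, negMulLog (∑ j, w (i, j)) + ∑ j, negMulLog (∑ i, w (i, j)) := by
  set a : m → ℝ := fun i => ∑ j, w (i, j) with ha
  set b : n → ℝ := fun j => ∑ i, w (i, j) with hb
  set t := ∑ x, w x with ht
  have hta : ∑ i, a i = t := (Fintype.sum_prod_type _).symm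
  have htb : ∑ j, b j = t := (Fintype.sum_prod_type_right _).symm
  have ha0 : ∀ i, 0 ≤ a i := fun i => Finset.sum_nonneg fun _ _ => hw _
  have hb0 : ∀ i, 0 ≤ b i := fun i => Finset.sum_nonneg fun _ _ => hw _
  have hwa : ∀ i j, w (i, j) ≤ a i := fun i j =>
    Finset.single_le_sum (f := fun j => w (i, j)) (fun _ _ => hw _) (Finset.mem_univ j)
  have hwb : ∀ i j, w (i, j) ≤ b j := fun i j =>
    Finset.single_le_sum (f := fun i => w (i, j)) (fun _ _ => hw _) (Finset.mem_univ i)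
  have key : ∀ i j, negMulLog (w (i, j)) ≤
      -(w (i, j) * log (a i)) - w (i, j) * log (b j) + w (i, j) * log t + a i * b j / t
        - w (i, j) := by
    intro i j
    by_cases h : a i * b j = 0
    · have h0 : w (i, j) = 0 := by
        rcases mul_eq_zero.1 h with h | h
        · exact le_antisymm (h ▸ hwa i j) (hw _)
        · exact le_antisymm (h ▸ hwb i j) (hw _)
      simp [h0, h]
    · have ha' : 0 < a i := (ha0 i).lt_of_ne' (left_ne_zero_of_mul h)
      have hb' : 0 < b j := (hb0 j).lt_of_ne' (right_ne_zero_of_mul h)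
      have ht' : 0 < t := by
        rw [← hta]
        exact Finset.sum_pos' (fun i _ => ha0 i) ⟨i, Finset.mem_univ i, ha'⟩
      have := negMulLog_le_gibbs (hw (i, j)) (y := a i * b j / t) (by positivity)
      rw [log_div h ht'.ne', log_mul ha'.ne' hb'.ne'] at this
      linarith
  have h1 := Finset.sum_le_sum fun i (_ : i ∈ Finset.univ) =>
    Finset.sum_le_sum fun j (_ : j ∈ Finset.univ) => key i j
  rw [← Fintype.sum_prod_type (f := fun x => negMulLog (w x))] at h1
  have e2 : ∑ i, ∑ j, w (i, j) * log (b j) = ∑ j, b j * log (b j) := by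
    rw [Finset.sum_comm]; simp only [hb, Finset.sum_mul]
  have e3 : ∑ i, ∑ j, w (i, j) = t := hta
  have e4 : ∑ i, ∑ j, a i * b j / t = t := by
    simp_rw [mul_div_assoc, ← Finset.mul_sum, ← Finset.sum_div, ← Finset.sum_mul, hta, htb]
    rcases eq_or_ne t 0 with h | h
    · simp [h]
    · field_simp
  simp only [Finset.sum_sub_distrib, Finset.sum_add_distrib, Finset.sum_neg_distrib, e2, e3, e4,
    ← Finset.sum_mul] at h1
  simp only [negMulLog, neg_mul, Finset.sum_neg_distrib] at h1 ⊢
  linarith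

/-- Subadditivity: measuring in a product of eigenbases of the two marginals gives a joint
distribution whose marginals are the spectra of the marginals. -/
theorem nent_subadditive {M : Matrix (m × n) (m × n) ℂ} (h : M.PosSemidef) :
    nent M ≤ nent (traceSnd M) + nent (traceFst M) := by
  obtain ⟨U, a, hU, hU', -, hA, -⟩ := exists_diagonalization (posSemidef_traceSnd h)
  obtain ⟨V, b, hV, hV', -, hB, -⟩ := exists_diagonalization (posSemidef_traceFst h)
  set W := U ⊗ₖ V
  have hW : Wᴴᴴ * Wᴴ = 1 := by
    rw [conjTranspose_conjTranspose]; exact mul_eq_one_comm.1 (kronecker_unitary hU hV)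
  have hP : (Wᴴ * M * W).PosSemidef := h.conjTranspose_mul_mul_same W
  have hvM : vN M = vN (Wᴴ * M * W) := by
    rw [← vN_conj hW M, conjTranspose_conjTranspose]
  have htM : M.trace = (Wᴴ * M * W).trace := by
    rw [← trace_conj hW M, conjTranspose_conjTranspose]
  have hSnd : traceSnd (Wᴴ * M * W) = diagonal fun i => (a i : ℂ) := by
    rw [traceSnd_conj U hV', hA, ← mul_assoc, ← mul_assoc, hU, one_mul, mul_assoc, hU, mul_one]
  have hFst : traceFst (Wᴴ * M * W) = diagonal fun i => (b i : ℂ) := by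
    rw [traceFst_conj hU' V, hB, ← mul_assoc, ← mul_assoc, hV, one_mul, mul_assoc, hV, mul_one]
  have h1 := sum_negMulLog_subadditive fun x => diag_re_nonneg hP x
  have ha : ∀ i, ∑ j, ((Wᴴ * M * W) (i, j) (i, j)).re = a i := by
    intro i
    have := congrArg Complex.re (congrFun (congrFun hSnd i) i)
    simpa [traceSnd] using this
  have hb : ∀ j, ∑ i, ((Wᴴ * M * W) (i, j) (i, j)).re = b j := by
    intro i
    have := congrArg Complex.re (congrFun (congrFun hFst i) i)
    simpa [traceFst] using this
  have ht : ∑ x, ((Wᴴ * M * W) x x).re = M.trace.re := by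
    rw [htM, trace, Complex.re_sum]; rfl
  simp only [ha, hb, ht] at h1
  have hvA : vN (traceSnd M) = ∑ i, negMulLog (a i) := by rw [hA, vN_conj hU, vN_diagonal]
  have hvB : vN (traceFst M) = ∑ i, negMulLog (b i) := by rw [hB, vN_conj hV, vN_diagonal]
  rw [nent, nent, nent, trace_traceSnd, trace_traceFst, hvA, hvB, hvM]
  linarith [vN_le_diag hP]

theorem vN_kronecker {M : Matrix m m ℂ} {N : Matrix n n ℂ} (hM : M.PosSemidef)
    (hN : N.PosSemidef) :
    vN (M ⊗ₖ N) = vN M * N.trace.re + M.trace.re * vN N := by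
  obtain ⟨U, a, hU, -, -, rfl, -⟩ := exists_diagonalization hM
  obtain ⟨V, b, hV, -, -, rfl, -⟩ := exists_diagonalization hN
  have h1 : (U * diagonal (fun i => (a i : ℂ)) * Uᴴ) ⊗ₖ (V * diagonal (fun i => (b i : ℂ)) * Vᴴ) =
      (U ⊗ₖ V) * diagonal (fun x : m × n => ((a x.1 * b x.2 : ℝ) : ℂ)) * (U ⊗ₖ V)ᴴ := by
    rw [mul_kronecker_mul, mul_kronecker_mul, diagonal_kronecker_diagonal,
      conjTranspose_kronecker]
    simp
  rw [h1, vN_conj (kronecker_unitary hU hV), vN_conj hU, vN_conj hV, trace_conj hU, trace_conj hV,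
    vN_diagonal, vN_diagonal, vN_diagonal, trace_diagonal, trace_diagonal]
  simp only [Complex.re_sum, Complex.ofReal_re, negMulLog_mul, Fintype.sum_prod_type,
    Finset.sum_add_distrib]
  simp only [← Finset.sum_mul, ← Finset.mul_sum]
  ring

/-! ### Conditional entropy -/

/-- The conditional entropy `S(XY) - S(X)` in nats of an unnormalized operator on `X ⊗ Y`. -/
noncomputable def condEnt (M : Matrix (m × n) (m × n) ℂ) : ℝ := vN M - vN (traceSnd M)

theorem condEnt_eq_nent (M : Matrix (m × n) (m × n) ℂ) :
    condEnt M = nent M - nent (traceSnd M) := by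
  rw [condEnt, nent, nent, trace_traceSnd]; ring

theorem nent_add_le {M N : Matrix m m ℂ} (hM : M.PosSemidef) (hN : N.PosSemidef) :
    nent (M + N) ≤ nent M + nent N + mixEntropy M.trace.re N.trace.re := by
  have := vN_add_le hM hN
  rw [nent, nent, nent, mixEntropy, trace_add, Complex.add_re]
  linarith

theorem condEnt_add_ge {M N : Matrix (m × n) (m × n) ℂ} (hM : M.PosSemidef) (hN : N.PosSemidef) :
    condEnt M + condEnt N - mixEntropy M.trace.re N.trace.re ≤ condEnt (M + N) := by
  have h1 := nent_add_ge hM hN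
  have h2 := nent_add_le (posSemidef_traceSnd hM) (posSemidef_traceSnd hN)
  rw [trace_traceSnd, trace_traceSnd] at h2
  rw [condEnt_eq_nent, condEnt_eq_nent, condEnt_eq_nent, traceSnd_add]
  linarith

theorem condEnt_add_le {M N : Matrix (m × n) (m × n) ℂ} (hM : M.PosSemidef) (hN : N.PosSemidef) :
    condEnt (M + N) ≤ condEnt M + condEnt N + mixEntropy M.trace.re N.trace.re := by
  have h1 := nent_add_ge (posSemidef_traceSnd hM) (posSemidef_traceSnd hN)
  have h2 := nent_add_le hM hN
  rw [condEnt_eq_nent, condEnt_eq_nent, condEnt_eq_nent, traceSnd_add]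
  linarith

theorem condEnt_le {M : Matrix (m × n) (m × n) ℂ} (hM : M.PosSemidef) :
    condEnt M ≤ nent (traceFst M) := by
  rw [condEnt_eq_nent]; linarith [nent_subadditive hM]

theorem nent_eq_of_vN {M : Matrix m m ℂ} {N : Matrix n n ℂ} (h : vN M = vN N)
    (ht : M.trace = N.trace) : nent M = nent N := by rw [nent, nent, h, ht]

/-- The Araki–Lieb inequality, from subadditivity applied to the complementary marginal of a
purification of `M`. -/
theorem neg_nent_le_condEnt {M : Matrix (m × n) (m × n) ℂ} (hM : M.PosSemidef) :
    -nent (traceFst M) ≤ condEnt M := by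
  obtain ⟨X, rfl, -⟩ := exists_sqrt_orthogonal hM
  set Y : Matrix m (n × (m × n)) ℂ := of fun i jk => X (i, jk.1) jk.2 with hY
  have h1 : traceSnd (X * Xᴴ) = Y * Yᴴ := by
    ext i j
    simp [traceSnd, mul_apply, hY, Fintype.sum_prod_type]
  have h2 : traceSnd (Yᴴ * Y) = (traceFst (X * Xᴴ))ᵀ := by
    ext i j
    simp only [traceSnd, traceFst, of_apply, mul_apply, transpose_apply, conjTranspose_apply, hY]
    rw [Finset.sum_comm]
    exact Finset.sum_congr rfl fun _ _ => Finset.sum_congr rfl fun _ _ => mul_comm _ _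
  have h3 : traceFst (Yᴴ * Y) = Xᴴ * X := by
    ext i j
    simp [traceFst, mul_apply, hY, Fintype.sum_prod_type_right]
  have h4 := nent_subadditive (posSemidef_conjTranspose_mul_self Y)
  rw [h2, h3] at h4
  have e1 : nent (Yᴴ * Y) = nent (traceSnd (X * Xᴴ)) := by
    rw [h1]; exact nent_eq_of_vN (vN_mul_comm _ _) (trace_mul_comm _ _)
  have e2 : nent (Xᴴ * X) = nent (X * Xᴴ) :=
    nent_eq_of_vN (vN_mul_comm _ _) (trace_mul_comm _ _)
  have e3 : nent (traceFst (X * Xᴴ))ᵀ = nent (traceFst (X * Xᴴ)) :=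
    nent_eq_of_vN (vN_transpose _) (trace_transpose _)
  rw [condEnt_eq_nent]
  linarith

theorem condEnt_le_rank {M : Matrix (m × n) (m × n) ℂ} (hM : M.PosSemidef) {d : ℕ}
    (hd : (traceFst M).rank ≤ d) : condEnt M ≤ M.trace.re * log d := by
  rw [← trace_traceFst]
  exact (condEnt_le hM).trans (nent_le_rank (posSemidef_traceFst hM) hd)

theorem neg_rank_le_condEnt {M : Matrix (m × n) (m × n) ℂ} (hM : M.PosSemidef) {d : ℕ}
    (hd : (traceFst M).rank ≤ d) : -(M.trace.re * log d) ≤ condEnt M := by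
  rw [← trace_traceFst]
  linarith [neg_nent_le_condEnt hM, nent_le_rank (posSemidef_traceFst hM) hd]

/-- A system uncorrelated with the rest does not change a conditional entropy. -/
theorem condEnt_kronecker {N : Matrix p p ℂ} {M : Matrix (m × n) (m × n) ℂ} (hN : N.PosSemidef)
    (hM : M.PosSemidef) :
    condEnt ((N ⊗ₖ M).submatrix (Equiv.prodAssoc p m n) (Equiv.prodAssoc p m n)) =
      N.trace.re * condEnt M := by
  have h : traceSnd ((N ⊗ₖ M).submatrix (Equiv.prodAssoc p m n) (Equiv.prodAssoc p m n)) =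
      N ⊗ₖ traceSnd M := by
    ext i j
    simp [traceSnd, Finset.mul_sum]
  rw [condEnt, vN_submatrix, h, vN_kronecker hN hM, vN_kronecker hN (posSemidef_traceSnd hM),
    trace_traceSnd, condEnt]
  ring

/-! ### Tensor powers -/

/-- The tensor power `M^{⊗ l}`, on systems indexed by functions on `Fin l`. -/
def tpow {a b : Type*} (l : ℕ) (M : Matrix a b ℂ) : Matrix (Fin l → a) (Fin l → b) ℂ :=
  of fun x y => ∏ i, M (x i) (y i)

theorem tpow_mul {a b m : Type*} [Fintype m] (l : ℕ) (M : Matrix a m ℂ) (N : Matrix m b ℂ) :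
    tpow l (M * N) = tpow l M * tpow l N := by
  ext x y
  simp only [tpow, of_apply, mul_apply]
  rw [Finset.prod_univ_sum, Fintype.piFinset_univ]
  exact Finset.sum_congr rfl fun _ _ => Finset.prod_mul_distrib

theorem tpow_conjTranspose {a b : Type*} (l : ℕ) (M : Matrix a b ℂ) :
    tpow l Mᴴ = (tpow l M)ᴴ := by
  ext x y
  simp [tpow]

theorem tpow_succ {a b : Type*} (l : ℕ) (M : Matrix a b ℂ) :
    tpow (l + 1) M = (M ⊗ₖ tpow l M).submatrix (Fin.consEquiv fun _ => a).symm
      (Fin.consEquiv fun _ => b).symm := by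
  ext x y
  simp [tpow, Fin.prod_univ_succ, Fin.consEquiv, Fin.tail]

theorem posSemidef_tpow (l : ℕ) {M : Matrix m m ℂ} (h : M.PosSemidef) :
    (tpow l M).PosSemidef := by
  obtain ⟨X, rfl, -⟩ := exists_sqrt_orthogonal h
  rw [tpow_mul, tpow_conjTranspose]
  exact posSemidef_self_mul_conjTranspose _

theorem trace_tpow {m : Type*} [Fintype m] (l : ℕ) (M : Matrix m m ℂ) :
    (tpow l M).trace = M.trace ^ l := by
  simp only [tpow, trace, diag_apply, of_apply]
  classical
  have h := Finset.prod_univ_sum (fun _ : Fin l => (Finset.univ : Finset m)) fun _ x => M x x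
  rw [Fintype.piFinset_univ] at h
  rw [← h]
  simp

theorem vN_tpow (l : ℕ) {M : Matrix m m ℂ} (h : M.PosSemidef) (ht : M.trace = 1) :
    vN (tpow l M) = l * vN M := by
  induction l with
  | zero =>
    have : tpow 0 M = diagonal fun _ => ((1 : ℝ) : ℂ) := by
      ext x y
      obtain rfl := Subsingleton.elim x y
      simp [tpow]
    rw [this, vN_diagonal]; simp
  | succ l ih =>
    rw [tpow_succ, vN_submatrix, vN_kronecker h (posSemidef_tpow l h), trace_tpow, ht, ih]
    push_cast
    simp
    ring

/-! ### Kraus representations -/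

/-- `Φ X = ∑ i, K i * X * (K i)ᴴ` for all `X`. -/
def HasKraus {m n ι : Type*} [Fintype m] [Fintype ι] (Φ : Matrix m m ℂ →ₗ[ℂ] Matrix n n ℂ)
    (K : ι → Matrix n m ℂ) : Prop :=
  ∀ X, Φ X = ∑ i, K i * X * (K i)ᴴ

/-- The Choi matrix of a completely positive map is positive semidefinite. -/
theorem posSemidef_choi {Φ : Matrix m m ℂ →ₗ[ℂ] Matrix n n ℂ} (h : IsCP Φ) :
    (of fun x y : m × n => Φ (single x.1 y.1 1) x.2 y.2).PosSemidef := by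
  let e := Fintype.equivFin m
  let v : Fin (Fintype.card m) × m → ℂ := fun x => if x.1 = e x.2 then 1 else 0
  have hX : vecMulVec v (star v) =
      ∑ i : m, ∑ j : m, single (e i) (e j) (1 : ℂ) ⊗ₖ single i j 1 := by
    ext ⟨a, i⟩ ⟨b, j⟩
    simp only [vecMulVec_apply, Pi.star_apply, Matrix.sum_apply, kroneckerMap_apply,
      single_apply, v]
    rw [Finset.sum_eq_single i, Finset.sum_eq_single j]
    · by_cases h1 : a = e i <;> by_cases h2 : b = e j <;> simp [h1, h2, eq_comm]
    · intro k _ hk; simp [hk]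
    · simp
    · intro k _ hk; simp [hk]
    · simp
  have h1 := h _ _ (posSemidef_vecMulVec_self_star v)
  rw [hX] at h1
  simp only [map_sum, tensorMap_kronecker, LinearMap.id_apply] at h1
  have h2 := h1.submatrix fun x : m × n => (e x.1, x.2)
  convert h2 using 1
  ext ⟨i, a⟩ ⟨j, b⟩
  simp only [of_apply, submatrix_apply, Matrix.sum_apply, kroneckerMap_apply, single_apply]
  rw [Finset.sum_eq_single i, Finset.sum_eq_single j]
  · simp
  · intro k _ hk; simp [hk]
  · simp
  · intro k _ hk; simp [hk]
  · simp

theorem exists_hasKraus {Φ : Matrix m m ℂ →ₗ[ℂ] Matrix n n ℂ} (h : IsCP Φ) :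
    ∃ K : m × n → Matrix n m ℂ, HasKraus Φ K := by
  obtain ⟨B, hB, -⟩ := exists_sqrt_orthogonal (posSemidef_choi h)
  refine ⟨fun c => of fun a i => B (i, a) c, fun X => ?_⟩
  have hΦ : ∀ i j a b, Φ (single i j 1) a b = ∑ c, B (i, a) c * star (B (j, b) c) := by
    intro i j a b
    have := congrFun (congrFun hB (i, a)) (j, b)
    simpa [mul_apply] using this
  ext a b
  have hX : Φ X a b = ∑ i, ∑ j, X i j * Φ (single i j 1) a b := by
    conv_lhs => rw [matrix_eq_sum_single X]
    simp only [map_sum, Matrix.sum_apply]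
    refine Finset.sum_congr rfl fun i _ => Finset.sum_congr rfl fun j _ => ?_
    rw [show single i j (X i j) = X i j • single i j (1 : ℂ) by simp [smul_single], map_smul]
    rfl
  rw [hX, Matrix.sum_apply]
  simp only [hΦ, mul_apply, of_apply, conjTranspose_apply, Finset.mul_sum, Finset.sum_mul]
  rw [Finset.sum_comm' (t' := Finset.univ) (s' := fun _ => Finset.univ) (by simp)]
  rw [Finset.sum_congr rfl fun j _ => Finset.sum_comm]
  rw [Finset.sum_comm]
  refine Finset.sum_congr rfl fun c _ => Finset.sum_congr rfl fun j _ =>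
    Finset.sum_congr rfl fun i _ => ?_
  ring

theorem sum_kraus_eq_one {n ι : Type*} [Fintype n] [Fintype ι] {Φ : Matrix m m ℂ →ₗ[ℂ] Matrix n n ℂ}
    {K : ι → Matrix n m ℂ} (hK : HasKraus Φ K) (h : IsTracePreserving Φ) :
    ∑ i, (K i)ᴴ * K i = 1 := by
  refine Matrix.ext_iff_trace_mul_right.2 fun X => ?_
  rw [one_mul, ← h X, hK X, trace_sum, Finset.sum_mul, trace_sum]
  refine Finset.sum_congr rfl fun i _ => ?_
  rw [trace_mul_comm (K i * X), Matrix.mul_assoc]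

theorem hasKraus_id : HasKraus (LinearMap.id : Matrix m m ℂ →ₗ[ℂ] _) fun _ : Unit => 1 := by
  intro X; simp

theorem HasKraus.tensorMap {ι κ : Type*} [Fintype ι] [Fintype κ]
    {Φ : Matrix m m ℂ →ₗ[ℂ] Matrix n n ℂ} {Ψ : Matrix p p ℂ →ₗ[ℂ] Matrix q q ℂ}
    {K : ι → Matrix n m ℂ} {L : κ → Matrix q p ℂ} (hK : HasKraus Φ K) (hL : HasKraus Ψ L) :
    HasKraus (tensorMap Φ Ψ) fun x : ι × κ => K x.1 ⊗ₖ L x.2 := by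
  intro X
  induction X using kronecker_induction with
  | h0 => simp
  | hadd X Y hX hY => simp only [map_add, hX, hY, Matrix.mul_add, Matrix.add_mul,
      Finset.sum_add_distrib]
  | hk A B =>
    rw [tensorMap_kronecker, hK, hL, Fintype.sum_prod_type]
    ext x y
    simp only [conjTranspose_kronecker, ← mul_kronecker_mul, Matrix.sum_apply, kroneckerMap_apply,
      Finset.sum_mul_sum]

theorem HasKraus.sum {m n κ ι : Type*} [Fintype m] [Fintype κ] [Fintype ι]
    {Φ : κ → (Matrix m m ℂ →ₗ[ℂ] Matrix n n ℂ)} {K : κ → ι → Matrix n m ℂ}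
    (h : ∀ k, HasKraus (Φ k) (K k)) :
    HasKraus (∑ k, Φ k) fun x : κ × ι => K x.1 x.2 := by
  intro X
  simp only [LinearMap.sum_apply, h _ X, Fintype.sum_prod_type]

theorem mul_pureState_mul {m n : Type*} [Fintype m] (C : Matrix n m ℂ) (v : m → ℂ) :
    C * pureState v * Cᴴ = pureState (C *ᵥ v) := by
  rw [pureState, pureState, mul_vecMulVec, vecMulVec_mul, star_mulVec]

/-! ### Fidelity with a pure state -/

theorem nonneg_of_mem_spectrum {S : Matrix m m ℂ} (h : S.PosSemidef) {x : ℝ}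
    (hx : x ∈ spectrum ℝ S) : 0 ≤ x := by
  rw [h.1.spectrum_real_eq_range_eigenvalues] at hx
  obtain ⟨i, rfl⟩ := hx
  exact h.eigenvalues_nonneg i

theorem cfc_sqrt_mul_self {S : Matrix m m ℂ} (h : S.PosSemidef) :
    cfc Real.sqrt (S * S) = S := by
  have h1 : S * S = cfc (fun x : ℝ => x * x) S := by
    rw [cfc_mul (fun x : ℝ => x) (fun x => x) S, cfc_id' ℝ S h.1.isSelfAdjoint]
  rw [h1, ← cfc_comp' Real.sqrt (fun x : ℝ => x * x) S (by fun_prop) (by fun_prop)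
    h.1.isSelfAdjoint]
  conv_rhs => rw [← cfc_id' ℝ S h.1.isSelfAdjoint]
  refine cfc_congr fun x hx => ?_
  exact Real.sqrt_mul_self (nonneg_of_mem_spectrum h hx)

theorem posSemidef_pureState {m : Type*} [Finite m] (v : m → ℂ) : (pureState v).PosSemidef :=
  posSemidef_vecMulVec_self_star v

theorem fidelity_pureState {ρ : Matrix m m ℂ} (hρ : ρ.PosSemidef) {t : m → ℂ}
    (ht : star t ⬝ᵥ t = 1) : fidelity ρ (pureState t) = (star t ⬝ᵥ ρ *ᵥ t).re := by
  have hP : pureState t * pureState t = pureState t := by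
    rw [pureState, vecMulVec_mul_vecMulVec, ht]; simp
  have hPs : cfc Real.sqrt (pureState t) = pureState t := by
    conv_lhs => rw [← hP]
    exact cfc_sqrt_mul_self (posSemidef_pureState t)
  have hR : cfc Real.sqrt ρ * cfc Real.sqrt ρ = ρ := by
    rw [← cfc_mul Real.sqrt Real.sqrt ρ]
    conv_rhs => rw [← cfc_id' ℝ ρ hρ.1.isSelfAdjoint]
    refine cfc_congr fun x hx => ?_
    exact Real.mul_self_sqrt (nonneg_of_mem_spectrum hρ hx)
  have hRh : (cfc Real.sqrt ρ)ᴴ = cfc Real.sqrt ρ := cfc_predicate (p := IsSelfAdjoint) Real.sqrt ρ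
  set c : ℂ := star t ⬝ᵥ ρ *ᵥ t with hc
  have hc0 : 0 ≤ c := hρ.dotProduct_mulVec_nonneg t
  have hcr : ((c.re : ℝ) : ℂ) = c := by
    refine Complex.ext rfl ?_
    simpa using (Complex.le_def.1 hc0).2
  have hcr0 : 0 ≤ c.re := (Complex.le_def.1 hc0).1
  have hX : (cfc Real.sqrt ρ * pureState t)ᴴ * (cfc Real.sqrt ρ * pureState t) =
      ((√c.re : ℝ) : ℂ) • pureState t * (((√c.re : ℝ) : ℂ) • pureState t) := by
    rw [conjTranspose_mul, (posSemidef_pureState t).1.eq, hRh, mul_assoc, ← mul_assoc (cfc _ _),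
      hR, smul_mul_smul_comm, ← Complex.ofReal_mul, Real.mul_self_sqrt hcr0, hP, hcr]
    rw [pureState, mul_vecMulVec, vecMulVec_mul_vecMulVec, ← hc]
    ext i j
    simp [vecMulVec_apply]
    ring
  have hpos : (((√c.re : ℝ) : ℂ) • pureState t).PosSemidef :=
    (posSemidef_pureState t).smul (by exact_mod_cast Real.sqrt_nonneg _)
  have htr : (pureState t).trace = 1 := by
    rw [pureState, trace_vecMulVec, dotProduct_comm, ht]
  rw [fidelity, hPs, traceNorm, hX, cfc_sqrt_mul_self hpos, trace_smul, htr]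
  simp [Real.sq_sqrt hcr0]

/-! ### Conditional entropy near a given vector -/

theorem smul_add_smul_mul_conjTranspose {m r : Type*} [Fintype r] (v w : Matrix m r ℂ) (x y : ℝ) :
    ((x : ℂ) • v + (y : ℂ) • w) * ((x : ℂ) • v + (y : ℂ) • w)ᴴ =
      ((x ^ 2 : ℝ) : ℂ) • (v * vᴴ) + ((x * y : ℝ) : ℂ) • (v * wᴴ + w * vᴴ) +
        ((y ^ 2 : ℝ) : ℂ) • (w * wᴴ) := by
  simp only [conjTranspose_add, conjTranspose_smul, Matrix.add_mul, Matrix.mul_add,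
    Matrix.smul_mul, Matrix.mul_smul, Complex.star_def, Complex.conj_ofReal]
  push_cast
  module

theorem trace_smul_add_smul {m r : Type*} [Fintype m] [Fintype r] {v w : Matrix m r ℂ}
    (h : (v * wᴴ).trace = 0) (x y : ℝ) :
    (((x : ℂ) • v + (y : ℂ) • w) * ((x : ℂ) • v + (y : ℂ) • w)ᴴ).trace.re =
      x ^ 2 * (v * vᴴ).trace.re + y ^ 2 * (w * wᴴ).trace.re := by
  have h' : (w * vᴴ).trace = 0 := by
    have := congrArg star h
    rwa [← trace_conjTranspose, conjTranspose_mul, conjTranspose_conjTranspose, star_zero] at this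
  rw [smul_add_smul_mul_conjTranspose]
  simp only [trace_add, trace_smul, h, h', smul_eq_mul, Complex.add_re, Complex.re_ofReal_mul]
  simp

/-- A lower bound on the conditional entropy of `v + w` for a small `w ⟂ v`. It rests on the
identity `|v + w⟩⟨v + w| + |z⟩⟨z| = (1 - s²)⁻¹ |v⟩⟨v| + |y⟩⟨y|` with `z` and `y` suitable
combinations of `v` and `w`, of squared norm of order `s` when `‖w‖ ≤ s`. Being linear in
the rank-one operators, the identity passes to marginals. -/
theorem condEnt_perturb {r : Type*} [Fintype r] {v w : Matrix (m × n) r ℂ} {s g : ℝ} {d : ℕ}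
    (hs0 : 0 < s) (hs1 : s < 1)
    (horth : (v * wᴴ).trace = 0)
    (hrank : ∀ x y : ℝ, (traceFst (((x : ℂ) • v + (y : ℂ) • w) *
      ((x : ℂ) • v + (y : ℂ) • w)ᴴ)).rank ≤ d)
    (hg : ∀ x : ℝ, condEnt (((x : ℂ) • v) * ((x : ℂ) • v)ᴴ) = x ^ 2 * g) :
    (1 - s ^ 2)⁻¹ * g
      - (s / (1 - s ^ 2) * (v * vᴴ).trace.re + 1 / s * (w * wᴴ).trace.re)
          * (log d + log ((1 + s) / s))
      - ((v * vᴴ).trace.re + (w * wᴴ).trace.re + (1 - s ^ 2)⁻¹ * (v * vᴴ).trace.re) * log (1 + s)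
      ≤ condEnt ((v + w) * (v + w)ᴴ) := by
  have h1s : 0 < 1 - s := by linarith
  have h1s' : 0 < 1 + s := by linarith
  have h1s2 : 0 < 1 - s ^ 2 := by nlinarith
  -- `|y⟩⟨y|` and `-|z⟩⟨z|` are the positive and the negative part of
  -- `|v + w⟩⟨v + w| - (1 - s²)⁻¹ |v⟩⟨v|` when `‖v‖² = 1 - s²` and `‖w‖ = s`.
  set a := √(s / (2 * (1 - s))) with ha
  set b := √((1 - s) / (2 * s)) with hb
  set c := √(s / (2 * (1 + s))) with hc
  set e := √((1 + s) / (2 * s)) with he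
  set k := √((1 - s ^ 2)⁻¹) with hk
  have ha2 : a ^ 2 = s / (2 * (1 - s)) := sq_sqrt (by positivity)
  have hb2 : b ^ 2 = (1 - s) / (2 * s) := sq_sqrt (by positivity)
  have hc2 : c ^ 2 = s / (2 * (1 + s)) := sq_sqrt (by positivity)
  have he2 : e ^ 2 = (1 + s) / (2 * s) := sq_sqrt (by positivity)
  have hk2 : k ^ 2 = (1 - s ^ 2)⁻¹ := sq_sqrt (by positivity)
  have hab : a * b = 1 / 2 := by
    rw [ha, hb, ← sqrt_mul (by positivity),
      show s / (2 * (1 - s)) * ((1 - s) / (2 * s)) = (1 / 2) ^ 2 by field_simp]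
    exact sqrt_sq (by norm_num)
  have hce : c * e = 1 / 2 := by
    rw [hc, he, ← sqrt_mul (by positivity),
      show s / (2 * (1 + s)) * ((1 + s) / (2 * s)) = (1 / 2) ^ 2 by field_simp]
    exact sqrt_sq (by norm_num)
  have hvv : 1 + a ^ 2 = k ^ 2 + c ^ 2 := by
    rw [ha2, hk2, hc2, show 1 - s ^ 2 = (1 - s) * (1 + s) by ring]
    field_simp
    ring
  have hww : 1 + b ^ 2 = e ^ 2 := by
    rw [hb2, he2]
    field_simp
    ring
  set Z := ((a : ℂ) • v + ((-b : ℝ) : ℂ) • w) * ((a : ℂ) • v + ((-b : ℝ) : ℂ) • w)ᴴ with hZ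
  set Y := ((c : ℂ) • v + (e : ℂ) • w) * ((c : ℂ) • v + (e : ℂ) • w)ᴴ with hY
  set V := ((k : ℂ) • v) * ((k : ℂ) • v)ᴴ with hV
  set R := (v + w) * (v + w)ᴴ with hR
  have hRv : R = (((1 : ℝ) : ℂ) • v + ((1 : ℝ) : ℂ) • w) *
      (((1 : ℝ) : ℂ) • v + ((1 : ℝ) : ℂ) • w)ᴴ := by simp [hR]
  have hVv : V = ((k : ℂ) • v + ((0 : ℝ) : ℂ) • w) * ((k : ℂ) • v + ((0 : ℝ) : ℂ) • w)ᴴ := by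
    simp [hV]
  have hid : R + Z = V + Y := by
    rw [hRv, hVv, hZ, hY]
    simp only [smul_add_smul_mul_conjTranspose]
    ext i j
    have g1 : ((1 + a ^ 2 : ℝ) : ℂ) = ((k ^ 2 + c ^ 2 : ℝ) : ℂ) := by rw [hvv]
    have g2 : ((1 + b ^ 2 : ℝ) : ℂ) = ((e ^ 2 : ℝ) : ℂ) := by rw [hww]
    have g3 : ((a * b : ℝ) : ℂ) = ((1 / 2 : ℝ) : ℂ) := by rw [hab]
    have g4 : ((c * e : ℝ) : ℂ) = ((1 / 2 : ℝ) : ℂ) := by rw [hce]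
    push_cast at g1 g2 g3 g4
    simp only [Matrix.add_apply, Matrix.smul_apply, smul_eq_mul]
    push_cast
    linear_combination g1 * (v * vᴴ) i j + g2 * (w * wᴴ) i j -
      (g3 + g4) * ((v * wᴴ) i j + (w * vᴴ) i j)
  have pR : R.PosSemidef := posSemidef_self_mul_conjTranspose _
  have pZ : Z.PosSemidef := posSemidef_self_mul_conjTranspose _
  have pV : V.PosSemidef := posSemidef_self_mul_conjTranspose _
  have pY : Y.PosSemidef := posSemidef_self_mul_conjTranspose _
  have tR : R.trace.re = (v * vᴴ).trace.re + (w * wᴴ).trace.re := by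
    rw [hRv, trace_smul_add_smul horth]; ring
  have tZ : Z.trace.re = a ^ 2 * (v * vᴴ).trace.re + b ^ 2 * (w * wᴴ).trace.re := by
    rw [hZ, trace_smul_add_smul horth]; ring
  have tV : V.trace.re = k ^ 2 * (v * vᴴ).trace.re := by
    rw [hVv, trace_smul_add_smul horth]; ring
  have tY : Y.trace.re = c ^ 2 * (v * vᴴ).trace.re + e ^ 2 * (w * wᴴ).trace.re := by
    rw [hY, trace_smul_add_smul horth]
  have i1 := condEnt_add_le pR pZ
  have i2 := condEnt_add_ge pV pY
  rw [hid] at i1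
  have i3 := condEnt_le_rank pZ (hrank a (-b))
  have i4 := neg_rank_le_condEnt pY (hrank c e)
  have i5 := mixEntropy_le (trace_re_nonneg pR) (trace_re_nonneg pZ) one_pos hs0
  have i6 := mixEntropy_le (trace_re_nonneg pV) (trace_re_nonneg pY) one_pos hs0
  have i7 : condEnt V = k ^ 2 * g := hg k
  have hT : s / (1 - s ^ 2) * (v * vᴴ).trace.re + 1 / s * (w * wᴴ).trace.re =
      Z.trace.re + Y.trace.re := by
    have e1 : s / (1 - s ^ 2) = a ^ 2 + c ^ 2 := by
      rw [ha2, hc2, show 1 - s ^ 2 = (1 - s) * (1 + s) by ring]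
      field_simp
      ring
    have e2 : 1 / s = b ^ 2 + e ^ 2 := by
      rw [hb2, he2]
      field_simp
      ring
    rw [tZ, tY, e1, e2]
    ring
  rw [div_one] at i5 i6
  rw [hT, ← hk2, ← tV, ← tR]
  linarith

/-! ### Comparison of a vector with its component along a target -/

section
variable {I J x e y c : Type*} [Fintype I] [Fintype J] [Fintype x] [Fintype e] [Fintype y]
  [Fintype c]

theorem sum_rotate_three {α β γ : Type*} [Fintype α] [Fintype β] [Fintype γ] (g : α → β → γ → ℂ) :
    ∑ a, ∑ b, ∑ d, g a b d = ∑ d, ∑ a, ∑ b, g a b d :=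
  (Finset.sum_congr rfl fun _ _ => Finset.sum_comm).trans Finset.sum_comm

/-- The amplitudes `M ((x, z), y)` are of the form `∑ k, Ψ (k, z) * Y (x, k, y)`. Then the marginal
of `M` on the system of `z` has rank at most the number of rows of `Ψ`. -/
def FactorsThrough {x e y c : Type*} [Fintype c] (Ψ : Matrix c e ℂ) (M : Matrix (x × e) y ℂ) :
    Prop :=
  ∃ Y : x → c → y → ℂ, ∀ i z j, M (i, z) j = ∑ k, Ψ k z * Y i k j

theorem FactorsThrough.smul_add_smul {x e y c : Type*} [Fintype c] {Ψ : Matrix c e ℂ}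
    {M N : Matrix (x × e) y ℂ}
    (hM : FactorsThrough Ψ M) (hN : FactorsThrough Ψ N) (a b : ℂ) :
    FactorsThrough Ψ (a • M + b • N) := by
  obtain ⟨Y, hY⟩ := hM
  obtain ⟨Y', hY'⟩ := hN
  refine ⟨fun i k j => a * Y i k j + b * Y' i k j, fun i z j => ?_⟩
  simp only [Matrix.add_apply, Matrix.smul_apply, hY, hY', smul_eq_mul, Finset.mul_sum,
    ← Finset.sum_add_distrib]
  exact Finset.sum_congr rfl fun k _ => by ring

theorem FactorsThrough.rank_traceFst_le {Ψ : Matrix c e ℂ} {M : Matrix (x × e) y ℂ}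
    (h : FactorsThrough Ψ M) : (traceFst (M * Mᴴ)).rank ≤ Fintype.card c := by
  obtain ⟨Y, hY⟩ := h
  let Y' : Matrix c (x × y) ℂ := of fun k ij => Y ij.1 k ij.2
  have h1 : traceFst (M * Mᴴ) = Ψᵀ * (Y' * (Ψᵀ * Y')ᴴ) := by
    rw [← Matrix.mul_assoc]
    ext z z'
    simp [traceFst, mul_apply, hY, Y', Fintype.sum_prod_type, mul_comm]
  rw [h1]
  exact (rank_mul_le_left _ _).trans (rank_le_card_width _)

/-- The partial inner product of the target `T` with `X`: a vector on the two environments `I` and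
`J`. The projection of `X` along `T` is `overlap T X ⊗ T`. -/
def overlap {I J n q e : Type*} [Fintype n] [Fintype q] [Fintype e] (T : Matrix (n × e) q ℂ)
    (X : Matrix ((I × n) × e) (q × J) ℂ) : Matrix I J ℂ :=
  of fun i j => ∑ a, ∑ z, ∑ y, star (T (a, z) y) * X ((i, a), z) (y, j)

/-- The product vector `ξ ⊗ T`. -/
def prodAmp {I J n q e : Type*} (ξ : Matrix I J ℂ) (T : Matrix (n × e) q ℂ) : Matrix ((I × n) × e)
    (q × J) ℂ :=
  of fun x y => ξ x.1.1 y.2 * T (x.1.2, x.2) y.1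

theorem prodAmp_mul_conjTranspose {I J n e q : Type*} [Fintype J] [Fintype q] (ξ : Matrix I J ℂ)
    (T : Matrix (n × e) q ℂ) :
    prodAmp ξ T * (prodAmp ξ T)ᴴ =
      ((ξ * ξᴴ) ⊗ₖ (T * Tᴴ)).submatrix (Equiv.prodAssoc I n e) (Equiv.prodAssoc I n e) := by
  ext ⟨⟨i, a⟩, z⟩ ⟨⟨i', a'⟩, z'⟩
  simp only [mul_apply, prodAmp, of_apply, conjTranspose_apply, submatrix_apply, kroneckerMap_apply,
    Equiv.prodAssoc_apply, Fintype.sum_prod_type_right, Finset.sum_mul_sum, star_mul']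
  exact Finset.sum_congr rfl fun _ _ => Finset.sum_congr rfl fun _ _ => by ring

theorem trace_prodAmp {n q : Type*} [Fintype n] [Fintype q] (ξ : Matrix I J ℂ)
    (T : Matrix (n × e) q ℂ) :
    (prodAmp ξ T * (prodAmp ξ T)ᴴ).trace = (ξ * ξᴴ).trace * (T * Tᴴ).trace := by
  rw [prodAmp_mul_conjTranspose, ← trace_kronecker]
  exact Equiv.sum_comp (Equiv.prodAssoc I n e) fun k => ((ξ * ξᴴ) ⊗ₖ (T * Tᴴ)) k k

theorem trace_prodAmp_overlap {n q : Type*} [Fintype n] [Fintype q] (T : Matrix (n × e) q ℂ)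
    (X : Matrix ((I × n) × e) (q × J) ℂ)
    (ξ : Matrix I J ℂ) :
    (prodAmp ξ T * Xᴴ).trace = (ξ * (overlap T X)ᴴ).trace := by
  simp only [trace, diag_apply, mul_apply, prodAmp, overlap, of_apply, conjTranspose_apply,
    Fintype.sum_prod_type, star_sum, star_mul', star_star, Finset.mul_sum]
  refine Finset.sum_congr rfl fun i _ => ?_
  calc _ = ∑ a, ∑ j, ∑ z, ∑ y, ξ i j * T (a, z) y * star (X ((i, a), z) (y, j)) :=
        Finset.sum_congr rfl fun a _ => sum_rotate_three _
    _ = _ := by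
      rw [Finset.sum_comm]
      refine Finset.sum_congr rfl fun j _ => Finset.sum_congr rfl fun a _ =>
        Finset.sum_congr rfl fun z _ => Finset.sum_congr rfl fun y _ => ?_
      ring

theorem condEnt_prodAmp {q : Type*} [Fintype q] [DecidableEq I] [DecidableEq e]
    (T : Matrix (n × e) q ℂ)
    (ξ : Matrix I J ℂ) (x : ℝ) :
    condEnt (((x : ℂ) • prodAmp ξ T) * ((x : ℂ) • prodAmp ξ T)ᴴ) =
      x ^ 2 * ((ξ * ξᴴ).trace.re * condEnt (T * Tᴴ)) := by
  have h : (x : ℂ) • prodAmp ξ T = prodAmp ((x : ℂ) • ξ) T := by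
    ext; simp [prodAmp, mul_assoc]
  rw [h, prodAmp_mul_conjTranspose, condEnt_kronecker (posSemidef_self_mul_conjTranspose _)
    (posSemidef_self_mul_conjTranspose _), conjTranspose_smul, Matrix.smul_mul, Matrix.mul_smul,
    trace_smul, trace_smul, Complex.star_def, Complex.conj_ofReal, smul_eq_mul, smul_eq_mul,
    Complex.re_ofReal_mul, Complex.re_ofReal_mul]
  ring

theorem trace_mul_conjTranspose_re (ξ : Matrix I J ℂ) :
    (ξ * ξᴴ).trace.re = ∑ i, ∑ j, Complex.normSq (ξ i j) := by
  simp only [trace, diag_apply, mul_apply, conjTranspose_apply, Complex.star_def, Complex.mul_conj,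
    Complex.re_sum, Complex.ofReal_re]

theorem trace_prodAmp_overlap_self {n q : Type*} [Fintype n] [Fintype q]
    {T : Matrix (n × e) q ℂ} (hT : (T * Tᴴ).trace = 1)
    (X : Matrix ((I × n) × e) (q × J) ℂ) :
    (prodAmp (overlap T X) T * (prodAmp (overlap T X) T)ᴴ).trace.re =
      ∑ i, ∑ j, Complex.normSq (overlap T X i j) := by
  rw [trace_prodAmp, hT, mul_one, trace_mul_conjTranspose_re]

theorem trace_prodAmp_sub {n q : Type*} [Fintype n] [Fintype q] {T : Matrix (n × e) q ℂ}
    (hT : (T * Tᴴ).trace = 1)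
    (X : Matrix ((I × n) × e) (q × J) ℂ) :
    (prodAmp (overlap T X) T * (X - prodAmp (overlap T X) T)ᴴ).trace = 0 := by
  rw [conjTranspose_sub, Matrix.mul_sub, trace_sub, trace_prodAmp, hT, mul_one,
    trace_prodAmp_overlap, sub_self]

theorem trace_sub_prodAmp {n q : Type*} [Fintype n] [Fintype q] {T : Matrix (n × e) q ℂ}
    (hT : (T * Tᴴ).trace = 1)
    (X : Matrix ((I × n) × e) (q × J) ℂ) :
    ((X - prodAmp (overlap T X) T) * (X - prodAmp (overlap T X) T)ᴴ).trace.re =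
      (X * Xᴴ).trace.re - ∑ i, ∑ j, Complex.normSq (overlap T X i j) := by
  have := trace_smul_add_smul (trace_prodAmp_sub hT X) 1 1
  simp only [Complex.ofReal_one, one_smul, add_sub_cancel, one_pow, one_mul] at this
  rw [this, trace_prodAmp_overlap_self hT]
  ring

/-- Lower bound on the conditional entropy of the system of `e` in a vector `X` that has large
overlap with a target `T`. -/
theorem condEnt_ge_of_overlap {q : Type*} [Fintype q] [DecidableEq I] [DecidableEq e]
    {Ψ : Matrix c e ℂ}
    {T : Matrix (n × e) q ℂ} {X : Matrix ((I × n) × e) (q × J) ℂ} (hT : (T * Tᴴ).trace = 1)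
    (hTΨ : FactorsThrough Ψ T) (hXΨ : FactorsThrough Ψ X) {s : ℝ} (hs0 : 0 < s) (hs1 : s < 1)
    {f t : ℝ} (hf : f = ∑ i, ∑ j, Complex.normSq (overlap T X i j)) (ht : t = (X * Xᴴ).trace.re) :
    (1 - s ^ 2)⁻¹ * (f * condEnt (T * Tᴴ))
      - (s / (1 - s ^ 2) * f + 1 / s * (t - f)) * (log (Fintype.card c) + log ((1 + s) / s))
      - (t + (1 - s ^ 2)⁻¹ * f) * log (1 + s)
      ≤ condEnt (X * Xᴴ) := by
  set ξ := overlap T X with hξ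
  set v := prodAmp ξ T with hv
  have horth : (v * (X - v)ᴴ).trace = 0 := trace_prodAmp_sub hT X
  have hvΨ : FactorsThrough Ψ v := by
    obtain ⟨Y, hY⟩ := hTΨ
    refine ⟨fun i k j => ξ i.1 j.2 * Y i.2 k j.1, fun i z j => ?_⟩
    simp only [hv, prodAmp, of_apply, hY, Finset.mul_sum]
    exact Finset.sum_congr rfl fun k _ => by ring
  have hwΨ : FactorsThrough Ψ (X - v) := by
    simpa [sub_eq_add_neg] using hXΨ.smul_add_smul hvΨ 1 (-1)
  have hfv : (v * vᴴ).trace.re = f := (trace_prodAmp_overlap_self hT X).trans hf.symm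
  have hw : ((X - v) * (X - v)ᴴ).trace.re = t - f := by
    rw [ht, hf]; exact trace_sub_prodAmp hT X
  have := condEnt_perturb hs0 hs1 horth
    (fun x y => (hvΨ.smul_add_smul hwΨ (x : ℂ) (y : ℂ)).rank_traceFst_le)
    (fun x => condEnt_prodAmp T ξ x)
  rwa [hw, hfv, add_sub_cancel, trace_mul_conjTranspose_re, ← hf, add_sub_cancel] at this

end

/-! ### The one-shot bound -/

section
variable {I J e c : Type*} [Fintype I] [DecidableEq I] [Fintype J] [Fintype e] [DecidableEq e]
  [Fintype c]

/-- The amplitudes of the vector obtained from `F` by the Kraus operators `A` of the first party;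
the label of the Kraus operator is kept as a system. -/
def afterA {I m n p e : Type*} [Fintype m] (A : I → Matrix n m ℂ) (F : Matrix m (p × e) ℂ) : Matrix
    ((I × n) × e) p ℂ :=
  of fun x b => ∑ k, A x.1.1 x.1.2 k * F k (b, x.2)

/-- The transpose of the isometry of the second party with Kraus operators `B`; the label of
the Kraus operator is kept as the environment `J`. -/
def stinespring {J p q : Type*} (B : J → Matrix q p ℂ) : Matrix p (q × J) ℂ :=
  of fun b y => B y.2 y.1 b

theorem stinespring_mul_conjTranspose {J p q : Type*} [Fintype J] [Fintype q] [DecidableEq p]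
    {B : J → Matrix q p ℂ} (hB : ∑ j, (B j)ᴴ * B j = 1) :
    stinespring B * (stinespring B)ᴴ = 1 := by
  have h := congrArg transpose hB
  rw [transpose_one] at h
  rw [← h]
  ext b b'
  simp only [stinespring, mul_apply, conjTranspose_apply, of_apply, transpose_apply,
    Matrix.sum_apply, Fintype.sum_prod_type_right]
  exact Finset.sum_congr rfl fun _ _ => Finset.sum_congr rfl fun _ _ => mul_comm _ _

/-- The operator with Kraus operators `A`, regarded as a map from the measured system to the output
and the label of the Kraus operator. -/
def stack {I m n : Type*} (A : I → Matrix n m ℂ) : Matrix (I × n) m ℂ := of fun x y => A x.1 x.2 y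

theorem traceSnd_afterA {I m n p e : Type*} [Fintype m] [Fintype p] [Fintype e]
    (A : I → Matrix n m ℂ) (F : Matrix m (p × e) ℂ) :
    traceSnd (afterA A F * (afterA A F)ᴴ) = (stack A * F) * (stack A * F)ᴴ := by
  ext x y
  simp only [traceSnd, afterA, stack, mul_apply, of_apply, conjTranspose_apply,
    Fintype.sum_prod_type_right]

theorem sum_stack {I n p e : Type*} [Fintype I] [Fintype n] {D : ℕ} {A : Fin D → I → Matrix n m ℂ}
    (hA : ∑ k, ∑ i, (A k i)ᴴ * A k i = 1)
    (F : Matrix m (p × e) ℂ) :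
    ∑ k, (stack (A k) * F)ᴴ * (stack (A k) * F) = Fᴴ * F := by
  have hSS : ∑ k, (stack (A k))ᴴ * stack (A k) = 1 := by
    rw [← hA]
    ext x y
    simp [stack, mul_apply, Matrix.sum_apply, Fintype.sum_prod_type]
  have : ∀ k, (stack (A k) * F)ᴴ * (stack (A k) * F) =
      Fᴴ * ((stack (A k))ᴴ * stack (A k)) * F := by
    intro k; simp only [conjTranspose_mul, Matrix.mul_assoc]
  simp_rw [this]
  rw [← Matrix.sum_mul, ← Matrix.mul_sum, hSS, Matrix.mul_one]

theorem sum_trace_afterA {I n p e : Type*} [Fintype I] [Fintype n] [Fintype p] [Fintype e] {D : ℕ}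
    {A : Fin D → I → Matrix n m ℂ}
    (hA : ∑ k, ∑ i, (A k i)ᴴ * A k i = 1) {F : Matrix m (p × e) ℂ} (hF : (Fᴴ * F).trace = 1) :
    ∑ k, (afterA (A k) F * (afterA (A k) F)ᴴ).trace.re = 1 := by
  have h : ∀ k, (afterA (A k) F * (afterA (A k) F)ᴴ).trace =
      ((stack (A k) * F)ᴴ * (stack (A k) * F)).trace := by
    intro k; rw [← trace_traceSnd, traceSnd_afterA, trace_mul_comm]
  simp_rw [h]
  rw [← Complex.re_sum, ← trace_sum, sum_stack hA, hF, Complex.one_re]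

/-- A measurement with `D` outcomes decreases the conditional entropy of the unmeasured systems, as
averaged over the outcomes, by at most `log D`. The conditional entropies after the measurement are
those of the complementary systems, with the opposite sign. -/
theorem sum_condEnt_afterA_le {D : ℕ} {A : Fin D → I → Matrix n m ℂ}
    (hA : ∑ k, ∑ i, (A k i)ᴴ * A k i = 1) {F : Matrix m (p × e) ℂ} (hF : (Fᴴ * F).trace = 1) :
    ∑ k, condEnt (afterA (A k) F * (afterA (A k) F)ᴴ) ≤ log D - condEnt (Fᴴ * F) := by
  set M : Fin D → Matrix (I × n) (p × e) ℂ := fun k => stack (A k) * F with hM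
  have hsum : ∑ k, (M k)ᴴ * M k = Fᴴ * F := sum_stack hA F
  have hpos : ∀ k, ((M k)ᴴ * M k).PosSemidef := fun k => posSemidef_conjTranspose_mul_self _
  have h1 : ∀ k, vN (traceSnd (afterA (A k) F * (afterA (A k) F)ᴴ)) = vN ((M k)ᴴ * M k) := by
    intro k
    rw [vN_mul_comm (M k)ᴴ, traceSnd_afterA]
  have h2 : ∀ k, vN (afterA (A k) F * (afterA (A k) F)ᴴ) = vN (traceSnd ((M k)ᴴ * M k)) := by
    intro k
    rw [vN_mul_comm]
    congr 1
    ext x y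
    simp only [traceSnd, afterA, hM, stack, mul_apply, of_apply, conjTranspose_apply,
      Fintype.sum_prod_type_right]
  have h3 : vN (Fᴴ * F) ≤ ∑ k, vN ((M k)ᴴ * M k) := by
    rw [← hsum]; exact vN_sum_le _ hpos
  have h4 : ∑ k, nent (traceSnd ((M k)ᴴ * M k)) ≤ nent (traceSnd (Fᴴ * F)) := by
    rw [← hsum, traceSnd_sum]; exact nent_sum_ge _ fun k => posSemidef_traceSnd (hpos k)
  have h5 : ∑ k, ((M k)ᴴ * M k).trace.re = 1 := by
    rw [← Complex.re_sum, ← trace_sum, hsum, hF, Complex.one_re]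
  have h6 : ∑ k, negMulLog ((M k)ᴴ * M k).trace.re ≤ log D := by
    have hD : 0 < D := by
      rcases Nat.eq_zero_or_pos D with rfl | h
      · simp at h5
      · exact h
    have hD' : (0 : ℝ) < D := by exact_mod_cast hD
    refine (Finset.sum_le_sum fun k _ => negMulLog_le_gibbs (trace_re_nonneg (hpos k))
      (y := (D : ℝ)⁻¹) (by positivity)).trans_eq ?_
    rw [Finset.sum_sub_distrib, Finset.sum_add_distrib, ← Finset.sum_mul, Finset.sum_neg_distrib,
      h5, log_inv]
    simp [hD'.ne']
  simp only [nent, trace_traceSnd, hF, Finset.sum_sub_distrib, Complex.one_re, negMulLog_one,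
    sub_zero] at h4
  simp only [condEnt, h1, h2, Finset.sum_sub_distrib]
  linarith

/-- One-shot form of the bound: the input is given by the amplitudes `F`, with marginal `Fᴴ * F` on
the second party and the reference, and the target by the amplitudes `T`. -/
theorem one_shot {q : Type*} [Fintype q] {D : ℕ} {A : Fin D → I → Matrix n m ℂ}
    {B : Fin D → J → Matrix q p ℂ}
    (hA : ∑ k, ∑ i, (A k i)ᴴ * A k i = 1) (hB : ∀ k, ∑ j, (B k j)ᴴ * B k j = 1)
    {F : Matrix m (p × e) ℂ} (hF : (Fᴴ * F).trace = 1)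
    {T : Matrix (n × e) q ℂ} (hT : (T * Tᴴ).trace = 1)
    {Ψ : Matrix c e ℂ} (hTΨ : FactorsThrough Ψ T)
    (hFΨ : FactorsThrough Ψ (of fun (x : m × e) (b : p) => F x.1 (b, x.2)))
    {s : ℝ} (hs0 : 0 < s) (hs1 : s ≤ 1 / 2) (hG : 0 ≤ condEnt (T * Tᴴ))
    (hfid : 1 - s ^ 2 ≤ ∑ k, ∑ i, ∑ j,
      Complex.normSq (overlap T (afterA (A k) F * stinespring (B k)) i j)) :
    condEnt (T * Tᴴ) + condEnt (Fᴴ * F) ≤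
      log D + 2 * s * (log (Fintype.card c) + log ((1 + s) / s))
        + (1 + (1 - s ^ 2)⁻¹) * log (1 + s) := by
  set X : Fin D → Matrix ((I × n) × e) (q × J) ℂ := fun k => afterA (A k) F * stinespring (B k)
    with hX
  have hXX : ∀ k, X k * (X k)ᴴ = afterA (A k) F * (afterA (A k) F)ᴴ := by
    intro k
    rw [hX, conjTranspose_mul, Matrix.mul_assoc, ← Matrix.mul_assoc (stinespring _),
      stinespring_mul_conjTranspose (hB k), Matrix.one_mul]
  have hXΨ : ∀ k, FactorsThrough Ψ (X k) := by
    obtain ⟨Y, hY⟩ := hFΨ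
    intro k
    refine ⟨fun i l j => ∑ b, ∑ x, A k i.1 i.2 x * Y x l b * stinespring (B k) b j,
      fun i z j => ?_⟩
    have hY' : ∀ x b z, F x (b, z) = ∑ l, Ψ l z * Y x l b := fun x b z => hY x z b
    simp only [hX, mul_apply, afterA, of_apply, hY', Finset.mul_sum, Finset.sum_mul]
    rw [sum_rotate_three]
    refine Finset.sum_congr rfl fun l _ => Finset.sum_congr rfl fun b _ =>
      Finset.sum_congr rfl fun x _ => ?_
    ring
  set f : Fin D → ℝ := fun k => ∑ i, ∑ j, Complex.normSq (overlap T (X k) i j) with hf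
  set t : Fin D → ℝ := fun k => (X k * (X k)ᴴ).trace.re with ht
  have hlow := Finset.sum_le_sum fun k (_ : k ∈ Finset.univ) =>
    condEnt_ge_of_overlap hT hTΨ (hXΨ k) hs0 (by linarith) (f := f k) (t := t k) rfl rfl
  have hup := sum_condEnt_afterA_le hA hF
  simp only [← hXX] at hup
  have htsum : ∑ k, t k = 1 := by
    simp only [ht, hXX]
    exact sum_trace_afterA hA hF
  set P := ∑ k, f k with hP
  have hPle : P ≤ 1 := by
    rw [← htsum]
    refine Finset.sum_le_sum fun k _ => ?_
    have := trace_re_nonneg (posSemidef_self_mul_conjTranspose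
      (X k - prodAmp (overlap T (X k)) T))
    rw [trace_sub_prodAmp hT] at this
    linarith
  simp only [Finset.sum_sub_distrib, ← Finset.mul_sum, ← Finset.sum_mul, Finset.sum_add_distrib,
    htsum, ← hP] at hlow
  have h1s2 : 0 < 1 - s ^ 2 := by nlinarith
  have hlog : 0 ≤ log (Fintype.card c) + log ((1 + s) / s) :=
    add_nonneg (log_natCast_nonneg _) (log_nonneg (by rw [le_div_iff₀ hs0]; linarith))
  have hlog2 : 0 ≤ log (1 + s) := log_nonneg (by linarith)
  have k1 : condEnt (T * Tᴴ) ≤ (1 - s ^ 2)⁻¹ * (P * condEnt (T * Tᴴ)) := by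
    rw [← mul_assoc]
    refine le_mul_of_one_le_left hG ?_
    rw [inv_mul_eq_div, one_le_div h1s2]
    exact hfid
  have k2 : s / (1 - s ^ 2) * P + 1 / s * (1 - P) ≤ 2 * s := by
    have e1 : s / (1 - s ^ 2) * P + 1 / s * (1 - P) =
        2 * s - (P - (1 - s ^ 2)) * (1 / s - s / (1 - s ^ 2)) := by
      field_simp
      ring
    have e2 : s / (1 - s ^ 2) ≤ 1 / s := by
      rw [div_le_div_iff₀ h1s2 hs0]; nlinarith
    rw [e1]
    linarith [mul_nonneg (sub_nonneg.2 hfid) (sub_nonneg.2 e2)]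
  have k3 : (1 - s ^ 2)⁻¹ * P ≤ (1 - s ^ 2)⁻¹ :=
    mul_le_of_le_one_right (by positivity) hPle
  have k4 := mul_le_mul_of_nonneg_right k2 hlog
  have k5 := mul_le_mul_of_nonneg_right k3 hlog2
  linarith

end

/-! ### The one-shot bound for one-way LOCC channels -/

section
variable {e : Type*} [Fintype e] [DecidableEq e]

theorem overlap_eq_dotProduct {m n p q I J : Type*} [Fintype m] [Fintype n] [Fintype p] [Fintype q]
    (A : I → Matrix n m ℂ) (B : J → Matrix q p ℂ)
    (u : (m × p) × e → ℂ) (t : (n × q) × e → ℂ) (i : I) (j : J) :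
    overlap (of fun (x : n × e) (y : q) => t ((x.1, y), x.2))
        (afterA A (of fun x (y : p × e) => u ((x, y.1), y.2)) * stinespring B) i j =
      star t ⬝ᵥ (((A i ⊗ₖ B j) ⊗ₖ (1 : Matrix e e ℂ)) *ᵥ u) := by
  have h : ∀ a y z, (((A i ⊗ₖ B j) ⊗ₖ (1 : Matrix e e ℂ)) *ᵥ u) ((a, y), z) =
      ∑ b, (∑ x, A i a x * u ((x, b), z)) * B j y b := by
    intro a y z
    simp only [mulVec, dotProduct, kroneckerMap_apply, Fintype.sum_prod_type, one_apply, mul_ite,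
      mul_one, mul_zero, ite_mul, zero_mul, Finset.sum_ite_eq, Finset.mem_univ, if_true,
      Finset.sum_mul]
    rw [Finset.sum_comm]
    exact Finset.sum_congr rfl fun _ _ => Finset.sum_congr rfl fun _ _ => by ring
  simp only [overlap, dotProduct, Fintype.sum_prod_type, h, of_apply, mul_apply, afterA,
    stinespring, Pi.star_apply]
  exact Finset.sum_congr rfl fun _ _ => Finset.sum_comm

theorem dotProduct_pureState_mulVec {m : Type*} [Fintype m] (t u : m → ℂ) :
    (star t ⬝ᵥ (pureState u *ᵥ t)).re = Complex.normSq (star t ⬝ᵥ u) := by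
  have h : star u ⬝ᵥ t = star (star t ⬝ᵥ u) := by
    rw [← star_dotProduct_star, star_star, dotProduct_comm]
  rw [pureState, vecMulVec_mulVec, dotProduct_smul, h]
  simp [Complex.normSq_apply]

/-- Lower bound on the number of outcomes `D` of a one-way LOCC channel that turns the pure state
`u` into a good approximation of the pure state `t`. -/
theorem IsOneWayLOCC.condEnt_le {c : Type*} [Fintype c] {D : ℕ}
    {ℳ : Matrix (m × p) (m × p) ℂ →ₗ[ℂ] Matrix (n × q) (n × q) ℂ} (hℳ : IsOneWayLOCC D ℳ)
    {u : (m × p) × e → ℂ} {t : (n × q) × e → ℂ}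
    {F : Matrix m (p × e) ℂ} (hFu : F = of fun x y => u ((x, y.1), y.2))
    (hF : (Fᴴ * F).trace = 1)
    {T : Matrix (n × e) q ℂ} (hTt : T = of fun x y => t ((x.1, y), x.2))
    (hT : (T * Tᴴ).trace = 1)
    {Ψ : Matrix c e ℂ} (hTΨ : FactorsThrough Ψ T)
    (hFΨ : FactorsThrough Ψ (of fun (x : m × e) (b : p) => F x.1 (b, x.2)))
    {s : ℝ} (hs0 : 0 < s) (hs1 : s ≤ 1 / 2) (hG : 0 ≤ condEnt (T * Tᴴ))
    (hfid : 1 - s ^ 2 ≤ fidelity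
      (tensorMap ℳ (LinearMap.id : Matrix e e ℂ →ₗ[ℂ] _) (pureState u)) (pureState t)) :
    condEnt (T * Tᴴ) + condEnt (Fᴴ * F) ≤
      log D + 2 * s * (log (Fintype.card c) + log ((1 + s) / s))
        + (1 + (1 - s ^ 2)⁻¹) * log (1 + s) := by
  obtain ⟨𝒜, ℬ, ⟨h𝒜, h𝒜t⟩, hℬ, rfl⟩ := hℳ
  choose A hA using fun k => exists_hasKraus (h𝒜 k).1
  choose B hB using fun k => exists_hasKraus (hℬ k).1
  have hℳK := (HasKraus.sum fun k => (hA k).tensorMap (hB k)).tensorMap (hasKraus_id (m := e))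
  have hA1 : ∑ k, ∑ i, (A k i)ᴴ * A k i = 1 := by
    have := sum_kraus_eq_one (HasKraus.sum hA) h𝒜t
    rwa [Fintype.sum_prod_type] at this
  have hB1 : ∀ k, ∑ j, (B k j)ᴴ * B k j = 1 := fun k => sum_kraus_eq_one (hB k) (hℬ k).2
  have ht1 : star t ⬝ᵥ t = 1 := by
    rw [← hT, hTt]
    simp only [trace, diag_apply, mul_apply, of_apply, conjTranspose_apply, dotProduct,
      Fintype.sum_prod_type, Pi.star_apply]
    refine Finset.sum_congr rfl fun _ _ => Finset.sum_comm.trans ?_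
    exact Finset.sum_congr rfl fun _ _ => Finset.sum_congr rfl fun _ _ => mul_comm _ _
  refine one_shot hA1 hB1 hF hT hTΨ hFΨ hs0 hs1 hG (hfid.trans_eq ?_)
  have hout := hℳK (pureState u)
  simp only [mul_pureState_mul] at hout
  rw [hout, fidelity_pureState (posSemidef_sum _ fun _ _ => posSemidef_pureState _) ht1,
    Matrix.sum_mulVec, dotProduct_sum, Complex.re_sum]
  simp only [dotProduct_pureState_mulVec, Fintype.sum_prod_type, Finset.univ_unique,
    Finset.sum_singleton]
  refine Finset.sum_congr rfl fun k _ => Finset.sum_congr rfl fun i _ =>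
    Finset.sum_congr rfl fun j _ => ?_
  simp only [hTt, hFu, overlap_eq_dotProduct]

end

/-! ### Marginals of tensor powers -/

theorem traceSnd_tpow {b e : Type*} [Fintype e] (l : ℕ) (M : Matrix (b × e) (b × e) ℂ) :
    traceSnd ((tpow l M).submatrix
      (Equiv.arrowProdEquivProdArrow (Fin l) (fun _ => b) fun _ => e).symm
      (Equiv.arrowProdEquivProdArrow (Fin l) (fun _ => b) fun _ => e).symm) =
      tpow l (traceSnd M) := by
  classical
  ext x y
  simp only [traceSnd, tpow, of_apply, submatrix_apply, Equiv.arrowProdEquivProdArrow_symm_apply]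
  rw [Finset.prod_univ_sum, Fintype.piFinset_univ]

theorem condEnt_tpow (l : ℕ) {M : Matrix (m × n) (m × n) ℂ} (hM : M.PosSemidef)
    (ht : M.trace = 1) :
    condEnt ((tpow l M).submatrix
      (Equiv.arrowProdEquivProdArrow (Fin l) (fun _ => m) fun _ => n).symm
      (Equiv.arrowProdEquivProdArrow (Fin l) (fun _ => m) fun _ => n).symm) = l * condEnt M := by
  rw [condEnt, traceSnd_tpow, vN_submatrix, vN_tpow l hM ht,
    vN_tpow l (posSemidef_traceSnd hM) ((trace_traceSnd M).trans ht), condEnt]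
  ring

/-- If the first system is uncorrelated with the second, conditioning on it is immaterial. -/
theorem condEnt_product {M : Matrix m m ℂ} {N : Matrix n n ℂ} (hM : M.PosSemidef)
    (hN : N.PosSemidef) (hMt : M.trace = 1) (hNt : N.trace = 1) : condEnt (M ⊗ₖ N) = vN N := by
  rw [condEnt, vN_kronecker hM hN, traceSnd_kronecker, hMt, hNt]
  simp

/-- A maximally entangled vector is a unit vector. -/
theorem IsMaxEntangled.trace_eq_one {K : ℕ} (hK : 1 ≤ K) {φ : Fin K × Fin K → ℂ}
    (h : IsMaxEntangled φ) :
    ((of fun i j => φ (i, j)) * (of fun i j => φ (i, j))ᴴ :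
      Matrix (Fin K) (Fin K) ℂ).trace = 1 := by
  obtain ⟨e, f, hφ⟩ := h
  have hON : ∀ g : OrthonormalBasis (Fin K) ℂ (EuclideanSpace ℂ (Fin K)),
      (of fun k i => g k i : Matrix (Fin K) (Fin K) ℂ) * (of fun k i => g k i)ᴴ = 1 := by
    intro g
    ext k k'
    have := orthonormal_iff_ite.1 g.orthonormal k' k
    rw [EuclideanSpace.inner_eq_star_dotProduct] at this
    simpa [mul_apply, dotProduct, one_apply, eq_comm] using this
  set E : Matrix (Fin K) (Fin K) ℂ := of fun k i => e k i with hE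
  set G : Matrix (Fin K) (Fin K) ℂ := of fun k i => f k i with hG
  have hφm : (of fun i j => φ (i, j) : Matrix (Fin K) (Fin K) ℂ) =
      ((1 / √K : ℝ) : ℂ) • (Eᵀ * G) := by
    ext i j
    simp [hφ, mul_apply, hE, hG]
  have hE' : (Eᵀ)ᴴ * Eᵀ = 1 := by
    have := congrArg transpose (hON e)
    rw [transpose_mul, transpose_one] at this
    exact this
  have hK' : (K : ℝ) ≠ 0 := by positivity
  rw [hφm, conjTranspose_smul, Matrix.smul_mul, Matrix.mul_smul, conjTranspose_mul,
    Matrix.mul_assoc, ← Matrix.mul_assoc G, hON f, Matrix.one_mul, trace_smul, trace_smul,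
    trace_mul_comm, hE', trace_one, Complex.star_def, Complex.conj_ofReal, smul_smul, smul_eq_mul,
    ← Complex.ofReal_mul, Fintype.card_fin, ← sq, div_pow, Real.sq_sqrt (by positivity)]
  push_cast
  field_simp

/-! ### Numerical estimate of the error terms -/

theorem log_two_mul_eta_of_le {x : ℝ} (h0 : 0 < x) (h : x ≤ 1 / exp 1) :
    log 2 * eta x = -x * log x := by
  have : log 2 ≠ 0 := (log_pos one_lt_two).ne'
  rw [eta, if_neg (not_le.2 h0), if_pos h, logb]
  field_simp

theorem log_two_mul_eta_of_gt {x : ℝ} (h : 1 / exp 1 < x) : log 2 * eta x = 1 / exp 1 := by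
  have h0 : 0 < x := lt_trans (by positivity) h
  have : log 2 ≠ 0 := (log_pos one_lt_two).ne'
  rw [eta, if_neg (not_le.2 h0), if_neg (not_le.2 h), logb, log_exp]
  field_simp

theorem eta_nonneg (x : ℝ) : 0 ≤ eta x := by
  rcases le_or_gt x 0 with h0 | h0
  · rw [eta, if_pos h0]
  · have h2 : 0 < log 2 := log_pos one_lt_two
    refine (mul_nonneg_iff_of_pos_left h2).1 ?_
    rcases le_or_gt x (1 / exp 1) with h | h
    · rw [log_two_mul_eta_of_le h0 h]
      have : x ≤ 1 := h.trans (by rw [div_le_one (exp_pos 1)]; exact one_le_exp zero_le_one)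
      exact negMulLog_nonneg h0.le this
    · rw [log_two_mul_eta_of_gt h]; positivity

theorem error_le {s : ℝ} (hs0 : 0 < s) (hs1 : s < 1 / 3) :
    2 * s * log ((1 + s) / s) + (1 + (1 - s ^ 2)⁻¹) * log (1 + s) ≤
      4 * s * log 2 + 3 * (log 2 * eta (2 * s)) := by
  have h1s2 : 0 < 1 - s ^ 2 := by nlinarith
  have hl1 : log (1 + s) ≤ s := by
    have := log_le_sub_one_of_pos (show 0 < 1 + s by linarith); linarith
  have hl0 : 0 ≤ log (1 + s) := log_nonneg (by linarith)
  have hα : (1 - s ^ 2)⁻¹ ≤ 9 / 8 := by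
    rw [inv_le_comm₀ h1s2 (by norm_num)]; nlinarith
  have hl2 := log_two_gt_d9
  have hdiv : log ((1 + s) / s) = log (1 + s) - log s := log_div (by linarith) hs0.ne'
  rcases le_or_gt (2 * s) (1 / exp 1) with h | h
  · -- here `-log s ≥ 1 + log 2`, which outweighs all terms linear in `s`
    rw [log_two_mul_eta_of_le (by linarith) h, log_mul two_ne_zero hs0.ne', hdiv]
    have hls : log s ≤ -1 - log 2 := by
      have := log_le_log (by linarith) h
      rw [log_mul two_ne_zero hs0.ne', log_div one_ne_zero (exp_pos 1).ne', log_exp,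
        log_one] at this
      linarith
    have e1 : (1 + (1 - s ^ 2)⁻¹) * log (1 + s) ≤ (1 + 9 / 8) * s := by gcongr
    have e2 : s * log (1 + s) ≤ s * (1 / 3) := by gcongr; linarith
    have e3 : s * log s ≤ s * (-1 - log 2) := by gcongr
    have e4 : s * log 2 ≥ 0 := by positivity
    nlinarith
  · rw [log_two_mul_eta_of_gt h]
    -- Gibbs' inequality against `(2/3, 1/3)` bounds the mixing entropy by its tangent at `s = 1/2`
    have hg := mixEntropy_le zero_le_one hs0.le (a := 2) (b := 1) two_pos one_pos
    have hm : mixEntropy 1 s = s * log ((1 + s) / s) + log (1 + s) := by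
      rw [hdiv, mixEntropy, negMulLog_one, negMulLog, negMulLog]; ring
    have h32 : log ((2 + 1) / 2) ≤ 1 / 2 := by
      have := log_le_sub_one_of_pos (show (0 : ℝ) < (2 + 1) / 2 by norm_num); linarith
    have h3 : log ((2 + 1) / 1) ≤ 1 / 2 + log 2 := by
      rw [show ((2 : ℝ) + 1) / 1 = (2 + 1) / 2 * 2 by norm_num,
        log_mul (by norm_num) two_ne_zero]
      linarith
    have he : (1.1 : ℝ) ≤ 3 * (1 / exp 1) := by
      have := exp_one_lt_d9
      rw [mul_one_div, le_div_iff₀ (exp_pos 1)]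
      linarith
    rw [hm] at hg
    have e1 : (1 + (1 - s ^ 2)⁻¹) * log (1 + s) ≤ 2 * log (1 + s) + s / 8 := by
      have : ((1 - s ^ 2)⁻¹ - 1) * log (1 + s) ≤ (1 / 8) * s := by
        apply mul_le_mul _ hl1 hl0 (by norm_num)
        linarith
      linarith
    have e2 : s * log ((2 + 1) / 1) ≤ s * (1 / 2 + log 2) := by gcongr
    nlinarith

/-! ### Marginals of the state to be merged -/

section
variable {a b e : Type*} [Fintype a] [DecidableEq a] [Fintype b] [DecidableEq b] [Fintype e]
  [DecidableEq e]

/-- The amplitudes of `ψ` as an operator between `A` and `BE`. -/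
def ampA {a b e : Type*} (ψ : (a × b) × e → ℂ) : Matrix a (b × e) ℂ :=
  of fun x y => ψ ((x, y.1), y.2)

/-- The amplitudes of `ψ` as an operator between `E` and `AB`. -/
def ampE {a b e : Type*} (ψ : (a × b) × e → ℂ) : Matrix e (a × b) ℂ :=
  of fun z x => ψ (x, z)

theorem vN_traceMid (ψ : (a × b) × e → ℂ) :
    vN (traceMid (pureState ψ)) = vN (traceSnd ((ampA ψ)ᴴ * ampA ψ)) := by
  set P : Matrix (a × e) b ℂ := of fun x y => ψ ((x.1, y), x.2)
  have h1 : traceMid (pureState ψ) = P * Pᴴ := by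
    ext x y
    simp [traceMid, pureState, vecMulVec_apply, mul_apply, P]
  have h2 : traceSnd ((ampA ψ)ᴴ * ampA ψ) = Pᴴ * P := by
    ext x y
    simp [traceSnd, ampA, mul_apply, P, Fintype.sum_prod_type_right]
  rw [h1, h2, vN_mul_comm]

theorem traceSnd_traceMid {a b e : Type*} [Fintype b] [Fintype e] (ψ : (a × b) × e → ℂ) :
    traceSnd (traceMid (pureState ψ)) = ampA ψ * (ampA ψ)ᴴ := by
  ext x y
  simp [traceMid, traceSnd, pureState, vecMulVec_apply, mul_apply, ampA,
    Fintype.sum_prod_type_right]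

theorem traceFst_traceMid {a b e : Type*} [Fintype a] [Fintype b] (ψ : (a × b) × e → ℂ) :
    traceFst (traceMid (pureState ψ)) = ampE ψ * (ampE ψ)ᴴ := by
  ext x y
  simp [traceMid, traceFst, pureState, vecMulVec_apply, mul_apply, ampE, Fintype.sum_prod_type]

theorem posSemidef_traceMid {a b e : Type*} [Finite a] [Fintype b] [Finite e]
    (ψ : (a × b) × e → ℂ) : (traceMid (pureState ψ)).PosSemidef := by
  have h1 : traceMid (pureState ψ) =
      (of fun (x : a × e) (y : b) => ψ ((x.1, y), x.2)) *
        (of fun (x : a × e) (y : b) => ψ ((x.1, y), x.2))ᴴ := by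
    ext x y
    simp [traceMid, pureState, vecMulVec_apply, mul_apply]
  rw [h1]
  exact posSemidef_self_mul_conjTranspose _

/-- `I(A;E) = S(E) + (S(BE) - S(B))` for a pure state of `ABE`. -/
theorem mutualInfo_traceMid (ψ : (a × b) × e → ℂ) :
    mutualInfo (traceMid (pureState ψ)) =
      (vN (ampE ψ * (ampE ψ)ᴴ) + condEnt ((ampA ψ)ᴴ * ampA ψ)) / log 2 := by
  have hM := posSemidef_traceMid ψ
  rw [mutualInfo, entropy_eq hM.1, entropy_eq (posSemidef_traceSnd hM).1,
    entropy_eq (posSemidef_traceFst hM).1, vN_traceMid, traceSnd_traceMid, traceFst_traceMid,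
    condEnt, vN_mul_comm (ampA ψ)]
  ring

theorem traceSnd_pureState {a b e : Type*} [Fintype e] (ψ : (a × b) × e → ℂ) :
    traceSnd (pureState ψ) = (ampE ψ)ᵀ * ((ampE ψ)ᵀ)ᴴ := by
  ext x y
  simp [traceSnd, pureState, vecMulVec_apply, mul_apply, ampE]

theorem transpose_mul_conjTranspose_transpose {m n : Type*} [Fintype m] (M : Matrix m n ℂ) :
    Mᵀ * (Mᵀ)ᴴ = (Mᴴ * M)ᵀ := by
  rw [transpose_mul]; rfl

theorem trace_ampE {a b e : Type*} [Fintype a] [Fintype b] [Fintype e] {ψ : (a × b) × e → ℂ}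
    (h : (traceSnd (pureState ψ)).trace = 1) : (ampE ψ * (ampE ψ)ᴴ).trace = 1 := by
  rw [← h, traceSnd_pureState, transpose_mul_conjTranspose_transpose, trace_transpose,
    trace_mul_comm]

theorem trace_ampA {a b e : Type*} [Fintype a] [Fintype b] [Fintype e] (ψ : (a × b) × e → ℂ) :
    ((ampA ψ)ᴴ * ampA ψ).trace = (ampE ψ * (ampE ψ)ᴴ).trace := by
  rw [trace_mul_comm, ← traceSnd_traceMid, trace_traceSnd, ← trace_traceFst, traceFst_traceMid]

/-- `I(A;E) ≤ 2 S(A) ≤ 2 log dim A`. -/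
theorem mutualInfo_traceMid_le {ψ : (a × b) × e → ℂ}
    (h : (traceSnd (pureState ψ)).trace = 1) :
    vN (ampE ψ * (ampE ψ)ᴴ) + condEnt ((ampA ψ)ᴴ * ampA ψ) ≤ 2 * log (Fintype.card a) := by
  set R := (ampE ψ)ᵀ
  have hρ : (R * Rᴴ).PosSemidef := posSemidef_self_mul_conjTranspose _
  have hE : vN (ampE ψ * (ampE ψ)ᴴ) = vN (R * Rᴴ) := by
    rw [transpose_mul_conjTranspose_transpose, vN_transpose, vN_mul_comm]
  have hA : traceSnd (R * Rᴴ) = ampA ψ * (ampA ψ)ᴴ := by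
    ext x y
    simp [R, traceSnd, ampE, ampA, mul_apply, Fintype.sum_prod_type]
  have hB : traceFst (R * Rᴴ) = (traceSnd ((ampA ψ)ᴴ * ampA ψ))ᵀ := by
    ext x y
    simp only [R, traceFst, traceSnd, ampE, ampA, mul_apply, of_apply, conjTranspose_apply,
      transpose_apply]
    rw [Finset.sum_comm]
    exact Finset.sum_congr rfl fun _ _ => Finset.sum_congr rfl fun _ _ => mul_comm _ _
  have h1 := nent_subadditive hρ
  have ht : (R * Rᴴ).trace = 1 := by rw [← traceSnd_pureState, h]
  have h2 := nent_le_rank (posSemidef_traceSnd hρ) (rank_le_card_width _)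
  rw [nent, nent, nent, trace_traceSnd, trace_traceFst] at h1
  rw [nent, trace_traceSnd] at h2
  simp only [ht, Complex.one_re, negMulLog_one, sub_zero,
    hA, hB, vN_transpose, one_mul] at h1 h2
  rw [condEnt, hE, vN_mul_comm (ampA ψ)ᴴ]
  linarith

end

/-! ### State merging of many copies -/

section
variable {a b e : Type*} [Fintype a] [DecidableEq a] [Fintype b] [DecidableEq b] [Fintype e]
  [DecidableEq e]

/-- The vector `ψ^{⊗ l}` on `A^l ⊗ B^l ⊗ E^l`. -/
def powVec {a b e : Type*} (l : ℕ) (ψ : (a × b) × e → ℂ) :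
    ((Fin l → a) × (Fin l → b)) × (Fin l → e) → ℂ :=
  fun x => tensorPower l ψ x.1.1 x.1.2 x.2

theorem ampE_powVec {a b e : Type*} [Fintype a] [Fintype b] (l : ℕ) (ψ : (a × b) × e → ℂ) :
    ampE (powVec l ψ) * (ampE (powVec l ψ))ᴴ = tpow l (ampE ψ * (ampE ψ)ᴴ) := by
  have h : ampE (powVec l ψ) = (tpow l (ampE ψ)).submatrix id
      (Equiv.arrowProdEquivProdArrow (Fin l) (fun _ => a) fun _ => b).symm := rfl
  rw [h, conjTranspose_submatrix, submatrix_mul_equiv, tpow_mul, tpow_conjTranspose]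
  rfl

theorem ampA_powVec {a b e : Type*} [Fintype a] (l : ℕ) (ψ : (a × b) × e → ℂ) :
    (ampA (powVec l ψ))ᴴ * ampA (powVec l ψ) = (tpow l ((ampA ψ)ᴴ * ampA ψ)).submatrix
      (Equiv.arrowProdEquivProdArrow (Fin l) (fun _ => b) fun _ => e).symm
      (Equiv.arrowProdEquivProdArrow (Fin l) (fun _ => b) fun _ => e).symm := by
  have h : ampA (powVec l ψ) = (tpow l (ampA ψ)).submatrix id
      (Equiv.arrowProdEquivProdArrow (Fin l) (fun _ => b) fun _ => e).symm := rfl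
  rw [h, conjTranspose_submatrix, tpow_mul, tpow_conjTranspose]
  rfl

/-- The bound for a single copy of a state `ψ` and entangled resources `φK` and `φL`, in nats. -/
theorem merging_one_copy {K L D : ℕ} {φK : Fin K × Fin K → ℂ} {φL : Fin L × Fin L → ℂ}
    (hφK : ((of fun i j => φK (i, j)) * (of fun i j => φK (i, j))ᴴ :
      Matrix (Fin K) (Fin K) ℂ).trace = 1)
    (hφL : ((of fun i j => φL (i, j)) * (of fun i j => φL (i, j))ᴴ :
      Matrix (Fin L) (Fin L) ℂ).trace = 1)
    {ψ : (a × b) × e → ℂ} (hψ : (ampE ψ * (ampE ψ)ᴴ).trace = 1)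
    {ℳ : Matrix ((Fin K × a) × (Fin K × b)) ((Fin K × a) × (Fin K × b)) ℂ →ₗ[ℂ]
      Matrix (Fin L × (Fin L × a × b)) (Fin L × (Fin L × a × b)) ℂ}
    (hℳ : IsOneWayLOCC D ℳ) {s : ℝ} (hs0 : 0 < s) (hs1 : s ≤ 1 / 2)
    (hfid : 1 - s ^ 2 ≤ fidelity
      (tensorMap ℳ (LinearMap.id : Matrix e e ℂ →ₗ[ℂ] _)
        (pureState fun x => φK (x.1.1.1, x.1.2.1) * ψ ((x.1.1.2, x.1.2.2), x.2)))
      (pureState fun x => φL (x.1.1, x.1.2.1) * ψ ((x.1.2.2.1, x.1.2.2.2), x.2))) :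
    vN (ampE ψ * (ampE ψ)ᴴ) + condEnt ((ampA ψ)ᴴ * ampA ψ) ≤
      log D + 2 * s * (log (Fintype.card (a × b)) + log ((1 + s) / s))
        + (1 + (1 - s ^ 2)⁻¹) * log (1 + s) := by
  have hψ' := (trace_ampA ψ).trans hψ
  set ΦK : Matrix (Fin K) (Fin K) ℂ := of fun i j => φK (i, j) with hΦK
  set ΦL : Matrix (Fin L) (Fin L) ℂ := of fun i j => φL (i, j) with hΦL
  set F : Matrix (Fin K × a) ((Fin K × b) × e) ℂ :=
    of fun x y => φK (x.1, y.1.1) * ψ ((x.2, y.1.2), y.2) with hF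
  set T : Matrix (Fin L × e) (Fin L × a × b) ℂ :=
    of fun x y => φL (x.1, y.1) * ψ ((y.2.1, y.2.2), x.2) with hT
  have hFF : Fᴴ * F = ((ΦKᴴ * ΦK) ⊗ₖ ((ampA ψ)ᴴ * ampA ψ)).submatrix
      (Equiv.prodAssoc (Fin K) b e) (Equiv.prodAssoc (Fin K) b e) := by
    rw [mul_kronecker_mul, ← conjTranspose_kronecker]
    rfl
  have hTT : T * Tᴴ = (ΦL * ΦLᴴ) ⊗ₖ (ampE ψ * (ampE ψ)ᴴ) := by
    rw [mul_kronecker_mul, ← conjTranspose_kronecker]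
    rfl
  have hφK' : (ΦKᴴ * ΦK).trace = 1 := by rw [trace_mul_comm, hφK]
  have hFt : (Fᴴ * F).trace = 1 := by
    rw [hFF]
    refine (Equiv.sum_comp (Equiv.prodAssoc (Fin K) b e)
      fun k => ((ΦKᴴ * ΦK) ⊗ₖ ((ampA ψ)ᴴ * ampA ψ)) k k).trans ?_
    exact (trace_kronecker _ _).trans (by rw [hφK', hψ', mul_one])
  have hTt : (T * Tᴴ).trace = 1 := by rw [hTT, trace_kronecker, hφL, hψ, mul_one]
  have hcT : condEnt (T * Tᴴ) = vN (ampE ψ * (ampE ψ)ᴴ) := by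
    rw [hTT]
    exact condEnt_product (posSemidef_self_mul_conjTranspose _)
      (posSemidef_self_mul_conjTranspose _) hφL hψ
  have hcF : condEnt (Fᴴ * F) = condEnt ((ampA ψ)ᴴ * ampA ψ) := by
    rw [hFF, condEnt_kronecker (posSemidef_conjTranspose_mul_self _)
      (posSemidef_conjTranspose_mul_self _), hφK', Complex.one_re, one_mul]
  have hTΨ : FactorsThrough (ampE ψ)ᵀ T := by
    refine ⟨fun i k j => if k = j.2 then φL (i, j.1) else 0, fun i z j => ?_⟩
    simp [hT, ampE, mul_comm]
  have hFΨ : FactorsThrough (ampE ψ)ᵀ (of fun (x : (Fin K × a) × e) (y : Fin K × b) =>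
      F x.1 (y, x.2)) := by
    refine ⟨fun i k j => if k = (i.2, j.2) then φK (i.1, j.1) else 0, fun i z j => ?_⟩
    simp [hF, ampE, mul_comm]
  have hG : 0 ≤ condEnt (T * Tᴴ) := by
    have := nent_nonneg (posSemidef_self_mul_conjTranspose (ampE ψ))
    rw [nent, hψ] at this
    rw [hcT]
    simpa using this
  rw [← hcT, ← hcF]
  exact hℳ.condEnt_le hF hFt hT hTt hTΨ hFΨ hs0 hs1 hG hfid

end

end StateMerging

open StateMerging in
theorem mainTheorem3 {a b e : Type*} [Fintype a] [DecidableEq a] [Fintype b] [DecidableEq b]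
    [Fintype e] [DecidableEq e]
    (ρ : Matrix (a × b) (a × b) ℂ) (hρ : StateMerging.IsState ρ)
    (ψ : (a × b) × e → ℂ) (hψ : StateMerging.IsPurification ψ ρ)
    (ε : ℝ) (hε : ε ∈ Set.Ioo (0 : ℝ) 1)
    (l K L D : ℕ) (hl : 1 ≤ l) (hK : 1 ≤ K) (hL : 1 ≤ L)
    (φK : Fin K × Fin K → ℂ) (hφK : StateMerging.IsMaxEntangled φK)
    (φL : Fin L × Fin L → ℂ) (hφL : StateMerging.IsMaxEntangled φL)
    (ℳ : Matrix ((Fin K × (Fin l → a)) × (Fin K × (Fin l → b)))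
          ((Fin K × (Fin l → a)) × (Fin K × (Fin l → b))) ℂ →ₗ[ℂ]
        Matrix (Fin L × (Fin L × (Fin l → a) × (Fin l → b)))
          (Fin L × (Fin L × (Fin l → a) × (Fin l → b))) ℂ)
    (hℳ : StateMerging.IsOneWayLOCC D ℳ)
    (hF : StateMerging.mergingFidelity l ℳ φK φL ψ ≥ 1 - ε) :
    (1 / (l : ℝ)) * Real.logb 2 D ≥
      StateMerging.mutualInfo (StateMerging.traceMid (StateMerging.pureState ψ))
        - 6 * Real.sqrt ε * ((1 / (l : ℝ)) * Real.logb 2 ((K : ℝ) * (L : ℝ))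
            + Real.logb 2 (Fintype.card (a × b)))
        - 3 * StateMerging.eta (2 * Real.sqrt ε) := by
  have htr : (traceSnd (pureState ψ)).trace = 1 := by rw [hψ, hρ.2]
  have hs0 : 0 < √ε := Real.sqrt_pos.2 hε.1
  have hs2 : √ε ^ 2 = ε := Real.sq_sqrt hε.1.le
  have hlR : (1 : ℝ) ≤ l := by exact_mod_cast hl
  have h2 : 0 < Real.log 2 := Real.log_pos one_lt_two
  have hKL : 0 ≤ Real.logb 2 ((K : ℝ) * (L : ℝ)) := by
    refine Real.logb_nonneg one_lt_two ?_
    exact_mod_cast Nat.mul_pos hK hL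
  have hη := eta_nonneg (2 * √ε)
  have hd0 : 0 ≤ Real.log (Fintype.card (a × b)) := Real.log_natCast_nonneg _
  have hD0 : 0 ≤ Real.log D := Real.log_natCast_nonneg _
  rw [mutualInfo_traceMid]
  set x := vN (ampE ψ * (ampE ψ).conjTranspose) + condEnt ((ampA ψ).conjTranspose * ampA ψ)
    with hx
  -- it suffices to bound `x` in nats, without the entangled resources
  suffices h : x ≤ Real.log D / l + 6 * √ε * Real.log (Fintype.card (a × b)) +
      3 * (Real.log 2 * eta (2 * √ε)) by
    have h3 : x / Real.log 2 ≤ 1 / l * Real.logb 2 D +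
        6 * √ε * Real.logb 2 (Fintype.card (a × b)) + 3 * eta (2 * √ε) := by
      rw [div_le_iff₀ h2, Real.logb, Real.logb]
      refine h.trans_eq ?_
      field_simp
    have h4 : 0 ≤ 6 * √ε * (1 / l * Real.logb 2 ((K : ℝ) * L)) := by positivity
    linarith
  have htriv : x ≤ 2 * Real.log (Fintype.card a) := mutualInfo_traceMid_le htr
  have hcard : Real.log (Fintype.card a) ≤ Real.log (Fintype.card (a × b)) := by
    have hne : Nonempty (a × b) := by
      by_contra h
      rw [not_nonempty_iff] at h
      simpa using hρ.2
    have hpos := Fintype.card_pos_iff.2 hne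
    rw [Fintype.card_prod] at hpos ⊢
    exact Real.log_le_log (by exact_mod_cast Nat.pos_of_mul_pos_right hpos)
      (by exact_mod_cast Nat.le_mul_of_pos_right _ (Nat.pos_of_mul_pos_left hpos))
  by_cases hcase : √ε < 1 / 3 ∧ 2 ≤ Fintype.card (a × b)
  · obtain ⟨hs, hd⟩ := hcase
    have hd2 : Real.log 2 ≤ Real.log (Fintype.card (a × b)) :=
      Real.log_le_log two_pos (by exact_mod_cast hd)
    have hmain := merging_one_copy (ψ := powVec l ψ) (hφK.trace_eq_one hK) (hφL.trace_eq_one hL)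
      (by rw [ampE_powVec, trace_tpow, trace_ampE htr, one_pow])
      hℳ hs0 (by linarith) (by rw [hs2]; exact hF)
    have hlog : Real.log (Fintype.card ((Fin l → a) × (Fin l → b))) =
        l * Real.log (Fintype.card (a × b)) := by
      rw [← Real.log_pow, ← Nat.cast_pow, Fintype.card_prod, Fintype.card_prod, Fintype.card_fun,
        Fintype.card_fun, Fintype.card_fin, mul_pow]
    rw [ampE_powVec, ampA_powVec, condEnt_tpow l (Matrix.posSemidef_conjTranspose_mul_self _)
      ((trace_ampA ψ).trans (trace_ampE htr)),
      vN_tpow l (Matrix.posSemidef_self_mul_conjTranspose _) (trace_ampE htr), ← mul_add, ← hx,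
      hlog] at hmain
    have herr := error_le hs0 hs
    have h3 : l * x ≤ Real.log D + l * (6 * √ε * Real.log (Fintype.card (a × b)) +
        3 * (Real.log 2 * eta (2 * √ε))) := by
      have h4 : √ε * Real.log 2 ≤ l * (√ε * Real.log (Fintype.card (a × b))) :=
        (mul_le_mul_of_nonneg_left hd2 hs0.le).trans (le_mul_of_one_le_left (by positivity) hlR)
      have h5 : Real.log 2 * eta (2 * √ε) ≤ l * (Real.log 2 * eta (2 * √ε)) :=
        le_mul_of_one_le_left (by positivity) hlR
      linarith
    have h6 : x = (l * x) / l := by field_simp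
    rw [h6, div_le_iff₀ (by positivity)]
    refine h3.trans_eq ?_
    field_simp
    ring
  · -- for large `ε`, or a trivial space, `I(A;E) ≤ 2 log dim A` suffices
    have h3 : x ≤ 6 * √ε * Real.log (Fintype.card (a × b)) := by
      rcases not_and_or.1 hcase with h | h
      · have := mul_le_mul_of_nonneg_right (not_lt.1 h) hd0
        linarith
      · have h0 : Real.log (Fintype.card (a × b)) = 0 := by
          have : Fintype.card (a × b) = 0 ∨ Fintype.card (a × b) = 1 := by omega
          rcases this with h | h <;> simp [h]
        rw [h0] at hcard ⊢
        linarith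
    have h4 : 0 ≤ Real.log D / l := by positivity
    have h5 : 0 ≤ 3 * (Real.log 2 * eta (2 * √ε)) := by positivity
    linarith
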